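/- Let $\mu$ be the Möbius function and $\operatorname{erf}(x)=\frac{2}{\sqrt{\pi}}\int_0^x e^{-t^2}\,dt$. For all real $X>1$ and $r\ge 1$, $$\frac12\sum_{n\ge1}\frac{\mu(n)}{rn+1}\left(X^{-(r+1/n)}-1\right)=-\frac12\int_0^\infty\left(\sum_{n\ge1}\frac{\mu(n)}{n^2}e^{-y/n^2}\right)e^{yr^2}\left(\operatorname{erf}\!\left(\sqrt{y}\left(r+\frac{\log X}{2y}\right)\right)-\operatorname{erf}\!\left(r\sqrt{y}\right)\right)dy,$$ where the series on the left converges (as the limit of its partial sums over $1\le n\le N$ as $N\to\infty$) and the integral on the right converges absolutely. -/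

import Mathlib

/-- The error function `erf x = (2/√π) ∫_0^x e^{-t²} dt` on the reals. -/
noncomputable def erf (x : ℝ) : ℝ :=
  2 / Real.sqrt Real.pi * ∫ t in (0 : ℝ)..x, Real.exp (-t ^ 2)

/-- The Riesz function `∑_{n ≥ 1} μ(n)/n² · e^{-y/n²}`. The series converges absolutely for `y ≥ 0`;
the term `n = 0` vanishes since `μ(0) = 0`. -/
noncomputable def rieszFunction (y : ℝ) : ℝ :=
  ∑' n : ℕ, (ArithmeticFunction.moebius n : ℝ) / (n : ℝ) ^ 2 * Real.exp (-y / (n : ℝ) ^ 2)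

section RieszFunction

open Filter Topology MeasureTheory Set
open scoped SchwartzMap FourierTransform

/-! Put `L = log X`. The weight multiplying the Riesz function equals ∫_0^L e^{-ru}
e^{-u²/(4y)}/√(πy) du, a superposition of heat kernels (`erfWeight_eq_integral`), so its Laplace
transform is elementary (`laplace_erfWeight`). Evaluating it at 1/n² for each term of the Riesz
series produces the series on the left.

Integrating term by term is not absolutely justified, since the resulting terms are only O(1/n). A
factor n^{-ε} is therefore inserted: for ε > 0 the exchange is legitimate
(`integral_dampedRiesz_mul`), and then ε → 0+ on both sides. The integral side needs a majorant
uniform in ε: the damped Riesz function is O(1/(√y (1 + log² y))) by `exists_dampedRiesz_bound`, and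
the weight is O(1/√y). The series side is an Abel theorem (`tendsto_tsum_mul_rpow_neg`), which needs
the undamped series to converge; this reduces to the convergence of ∑ μ(n)/n.

Both inputs have the strength of the prime number theorem and come from one estimate,
`exists_smoothedMoebius_bound`. The sum ∑ μ(n) n^{-1-ε} k(v - log n) is the inverse Fourier
transform of 𝓕k times 1/ζ on the line Re s = 1 + ε. By a quantitative 3-4-1 argument, 1/ζ and its
first two derivatives grow polynomially in 1 < Re s ≤ 2, uniformly up to the edge, so the sum is
O(1/(1 + v²)) uniformly in ε. The kernel e^u exp(-e^{2u}) yields the damped Riesz function; a bump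
kernel yields the increments of smoothed partial sums of ∑ μ(n)/n. -/

/-! ### Continuation of ζ by the fractional part -/

/-- The Mellin transform of the fractional part on `(1, ∞)`, evaluated at `-s`. -/
noncomputable def fractMellin (s : ℂ) : ℂ :=
  mellin ((Ioi (1 : ℝ)).indicator fun t : ℝ => ((Int.fract t : ℝ) : ℂ)) (-s)

lemma fractMellin_eq_integral (s : ℂ) :
    fractMellin s = ∫ t in Ioi (1 : ℝ), (t : ℂ) ^ (-s - 1) * ((Int.fract t : ℝ) : ℂ) := by
  have h : ∀ t : ℝ, (t : ℂ) ^ (-s - 1) •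
      (Ioi (1 : ℝ)).indicator (fun t : ℝ => ((Int.fract t : ℝ) : ℂ)) t =
      (Ioi (1 : ℝ)).indicator (fun t : ℝ => (t : ℂ) ^ (-s - 1) * ((Int.fract t : ℝ) : ℂ)) t := by
    intro t
    by_cases ht : t ∈ Ioi (1 : ℝ) <;> simp [ht]
  rw [fractMellin, mellin]
  simp_rw [h]
  rw [setIntegral_indicator measurableSet_Ioi,
    inter_eq_self_of_subset_right (Ioi_subset_Ioi zero_le_one)]

lemma norm_cpow_mul_fract_le (s : ℂ) {t : ℝ} (ht : 1 < t) :
    ‖(t : ℂ) ^ (-s - 1) * ((Int.fract t : ℝ) : ℂ)‖ ≤ t ^ (-s.re - 1) := by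
  rw [norm_mul, Complex.norm_cpow_eq_rpow_re_of_pos (by linarith), Complex.norm_real,
    Real.norm_of_nonneg (Int.fract_nonneg t)]
  simpa using mul_le_of_le_one_right (Real.rpow_nonneg (by linarith : (0:ℝ) ≤ t) _)
    (Int.fract_lt_one t).le

lemma norm_fractMellin_le {s : ℂ} (hs : 0 < s.re) : ‖fractMellin s‖ ≤ 1 / s.re := by
  rw [fractMellin_eq_integral]
  have hi : IntegrableOn (fun t : ℝ => t ^ (-s.re - 1)) (Ioi 1) :=
    integrableOn_Ioi_rpow_of_lt (by linarith) one_pos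
  refine (norm_integral_le_of_norm_le hi ?_).trans ?_
  · exact ae_restrict_of_forall_mem measurableSet_Ioi fun t ht => norm_cpow_mul_fract_le s ht
  · rw [integral_Ioi_rpow_of_lt (by linarith) one_pos]
    simp [neg_div_neg_eq]

lemma differentiableAt_fractMellin {s : ℂ} (hs : 0 < s.re) :
    DifferentiableAt ℂ fractMellin s := by
  have hb : ∀ t : ℝ, ‖(Ioi (1 : ℝ)).indicator (fun t : ℝ => ((Int.fract t : ℝ) : ℂ)) t‖ ≤ 1 := by
    intro t
    refine (norm_indicator_le_norm_self _ _).trans ?_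
    rw [Complex.norm_real, Real.norm_of_nonneg (Int.fract_nonneg t)]
    exact (Int.fract_lt_one t).le
  have hm : Measurable ((Ioi (1 : ℝ)).indicator fun t : ℝ => ((Int.fract t : ℝ) : ℂ)) :=
    (Complex.measurable_ofReal.comp measurable_fract).indicator measurableSet_Ioi
  have key : DifferentiableAt ℂ
      (mellin ((Ioi (1 : ℝ)).indicator fun t : ℝ => ((Int.fract t : ℝ) : ℂ))) (-s) := by
    -- Boundedness at infinity gives the exponent `a = 0`; vanishing near `0` allows any `b`, and
    -- any value below the real part of `-s` will do.
    refine mellin_differentiableAt_of_isBigO_rpow (a := 0) (b := -s.re - 1) ?_ ?_ (by simpa) ?_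
      (by simp)
    · refine ((locallyIntegrable_const (1 : ℝ)).mono hm.aestronglyMeasurable ?_).locallyIntegrableOn _
      exact Eventually.of_forall fun t => by simpa using hb t
    · refine Asymptotics.IsBigO.of_bound 1 (Eventually.of_forall fun t => ?_)
      simpa using hb t
    · refine Asymptotics.IsBigO.of_bound 0 ?_
      filter_upwards [Ioo_mem_nhdsGT (zero_lt_one' ℝ)] with t ht
      simp [ht.2.le]
  exact key.comp s differentiableAt_id.neg

/-- Partial summation gives ζ(s) = s ∫ ⌊t⌋ t^{-s-1} dt over t > 1; then split ⌊t⌋ = t - {t}. -/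
lemma riemannZeta_eq_fractMellin {s : ℂ} (hs : 1 < s.re) :
    riemannZeta s = s / (s - 1) - s * fractMellin s := by
  have h1 : (fun n : ℕ => ∑ k ∈ Finset.Icc 1 n, ((fun _ => 1 : ℕ → ℝ)) k)
      =O[atTop] fun n => (n : ℝ) ^ (1 : ℝ) := by
    simpa using Asymptotics.isBigO_refl _ _
  have h2 := LSeries_eq_mul_integral_of_nonneg (fun _ => 1) zero_le_one hs h1
    (fun _ => zero_le_one)
  have h3 : LSeries (fun _ : ℕ => (((1 : ℝ)) : ℂ)) s = riemannZeta s := by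
    rw [← LSeries_one_eq_riemannZeta hs]
    exact LSeries_congr (by intro n _; simp) s
  rw [← h3, h2, fractMellin_eq_integral]
  have hcp : IntegrableOn (fun t : ℝ => (t : ℂ) ^ (-s)) (Ioi 1) :=
    integrableOn_Ioi_cpow_of_lt (by simpa using hs) one_pos
  have hfr : IntegrableOn (fun t : ℝ => (t : ℂ) ^ (-s - 1) * ((Int.fract t : ℝ) : ℂ)) (Ioi 1) := by
    have hi : IntegrableOn (fun t : ℝ => t ^ (-s.re - 1)) (Ioi 1) :=
      integrableOn_Ioi_rpow_of_lt (by linarith) one_pos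
    refine hi.mono' ?_ (ae_restrict_of_forall_mem measurableSet_Ioi
      fun t ht => norm_cpow_mul_fract_le s ht)
    refine AEStronglyMeasurable.mul ?_ (Complex.measurable_ofReal.comp
      measurable_fract).aestronglyMeasurable
    refine ContinuousOn.aestronglyMeasurable (fun t ht => ?_) measurableSet_Ioi
    have : (t : ℂ) ∈ Complex.slitPlane := by
      rw [Complex.ofReal_mem_slitPlane]; exact zero_lt_one.trans ht
    exact (Complex.continuous_ofReal.continuousAt.cpow continuousAt_const this).continuousWithinAt
  have h4 : ∫ t in Ioi (1 : ℝ), (∑ k ∈ Finset.Icc 1 ⌊t⌋₊, ((1 : ℝ) : ℂ)) * (t : ℂ) ^ (-(s + 1)) =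
      ∫ t in Ioi (1 : ℝ), ((t : ℂ) ^ (-s) - (t : ℂ) ^ (-s - 1) * ((Int.fract t : ℝ) : ℂ)) := by
    refine setIntegral_congr_fun measurableSet_Ioi fun t ht => ?_
    have ht0 : (0 : ℝ) < t := zero_lt_one.trans ht
    have h5 : ((⌊t⌋₊ : ℝ)) = t - Int.fract t := by
      rw [natCast_floor_eq_intCast_floor ht0.le, Int.self_sub_fract]
    have h6 : (t : ℂ) ^ (-s) = (t : ℂ) ^ (-s - 1) * t := by
      have : (t : ℂ) ≠ 0 := by exact_mod_cast ht0.ne'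
      rw [Complex.cpow_sub _ _ this, Complex.cpow_one, div_mul_cancel₀ _ this]
    have h7 : (⌊t⌋₊ : ℂ) = (t : ℂ) - ((Int.fract t : ℝ) : ℂ) := by
      rw [← Complex.ofReal_sub, ← h5]; simp
    simp only [Complex.ofReal_one, Finset.sum_const, Nat.card_Icc, add_tsub_cancel_right,
      nsmul_eq_mul, mul_one]
    rw [h7, h6, neg_add']
    ring
  rw [h4, integral_sub hcp hfr, integral_Ioi_cpow_of_lt (by simpa using hs) one_pos]
  have : s - 1 ≠ 0 := fun h => by
    have := congrArg Complex.re h; simp at this; linarith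
  have h8 : -s + 1 ≠ 0 := fun h => this (by linear_combination -h)
  simp only [Complex.ofReal_one, Complex.one_cpow]
  field_simp
  ring

/-- Both sides are analytic on the right half-plane and agree near `2`, so the identity theorem
applies. It supplies bounds to the left of Re s = 1. -/
lemma riemannZeta₁_eq_fractMellin {s : ℂ} (hs : 0 < s.re) :
    riemannZeta₁ s = s - s * (s - 1) * fractMellin s := by
  have hopen : IsOpen {s : ℂ | 0 < s.re} := isOpen_lt continuous_const Complex.continuous_re
  have hf : AnalyticOnNhd ℂ riemannZeta₁ {s : ℂ | 0 < s.re} :=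
    (differentiable_riemannZeta₁.differentiableOn).analyticOnNhd hopen
  have hg : AnalyticOnNhd ℂ (fun s => s - s * (s - 1) * fractMellin s) {s : ℂ | 0 < s.re} := by
    refine DifferentiableOn.analyticOnNhd (fun z hz => ?_) hopen
    have := differentiableAt_fractMellin hz
    exact (by fun_prop : DifferentiableAt ℂ (fun s => s - s * (s - 1) * fractMellin s) z)
      |>.differentiableWithinAt
  refine hf.eqOn_of_preconnected_of_eventuallyEq hg (convex_halfSpace_re_gt 0).isPreconnected
    (z₀ := 2) (by simp) ?_ hs
  filter_upwards [(isOpen_lt continuous_const Complex.continuous_re).mem_nhds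
    (show (1:ℝ) < (2:ℂ).re by simp)] with z hz
  have hz1 : z ≠ 1 := fun h => by simp [h] at hz
  have h1 := riemannZeta_eq_inv_sub_mul hz1
  rw [riemannZeta_eq_fractMellin hz] at h1
  have : z - 1 ≠ 0 := sub_ne_zero.2 hz1
  field_simp at h1
  linear_combination -h1

/-! ### Polynomial growth of (s - 1)ζ(s) and its derivatives -/

/-- A family of complex functions on the strip `1 < re s ≤ b` has polynomial growth. -/
def PolyGrowth (b : ℝ) (f : ℂ → ℂ) : Prop :=
  ∃ (C : ℝ) (A : ℕ), 0 ≤ C ∧ ∀ s : ℂ, 1 < s.re → s.re ≤ b → ‖f s‖ ≤ C * (1 + |s.im|) ^ A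

lemma PolyGrowth.mul {b : ℝ} {f g : ℂ → ℂ} (hf : PolyGrowth b f) (hg : PolyGrowth b g) :
    PolyGrowth b fun s => f s * g s := by
  obtain ⟨C, A, hC, h1⟩ := hf
  obtain ⟨D, B, hD, h2⟩ := hg
  refine ⟨C * D, A + B, by positivity, fun s hs hb => ?_⟩
  rw [norm_mul, pow_add, mul_mul_mul_comm]
  exact mul_le_mul (h1 s hs hb) (h2 s hs hb) (norm_nonneg _) (by positivity)

lemma PolyGrowth.add {b : ℝ} {f g : ℂ → ℂ} (hf : PolyGrowth b f) (hg : PolyGrowth b g) :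
    PolyGrowth b fun s => f s + g s := by
  obtain ⟨C, A, hC, h1⟩ := hf
  obtain ⟨D, B, hD, h2⟩ := hg
  refine ⟨C + D, A + B, by positivity, fun s hs hb => (norm_add_le _ _).trans ?_⟩
  have h : (1 : ℝ) ≤ 1 + |s.im| := by simp
  rw [add_mul]
  refine add_le_add ((h1 s hs hb).trans ?_) ((h2 s hs hb).trans ?_)
  · exact mul_le_mul_of_nonneg_left (pow_le_pow_right₀ h (by omega)) hC
  · exact mul_le_mul_of_nonneg_left (pow_le_pow_right₀ h (by omega)) hD

lemma PolyGrowth.const (b : ℝ) (c : ℂ) : PolyGrowth b fun _ => c :=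
  ⟨‖c‖, 0, norm_nonneg c, fun s _ _ => by simp⟩

lemma norm_le_of_re_mem {s : ℂ} {b : ℝ} (h0 : 0 < s.re) (hb : s.re ≤ b) :
    ‖s‖ ≤ (1 + b) * (1 + |s.im|) := by
  have := Complex.norm_le_abs_re_add_abs_im s
  rw [abs_of_pos h0] at this
  nlinarith [abs_nonneg s.im]

lemma PolyGrowth.id (b : ℝ) (hb : 0 ≤ b) : PolyGrowth b fun s => s :=
  ⟨1 + b, 1, by positivity, fun s h1 h2 => by
    simpa using norm_le_of_re_mem (zero_lt_one.trans h1) h2⟩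

lemma norm_riemannZeta₁_le {s : ℂ} (hs : 1 / 2 ≤ s.re) :
    ‖riemannZeta₁ s‖ ≤ 3 * (1 + ‖s‖) ^ 2 := by
  have h0 : 0 < s.re := by linarith
  rw [riemannZeta₁_eq_fractMellin h0]
  have h1 : ‖fractMellin s‖ ≤ 2 := (norm_fractMellin_le h0).trans
    ((div_le_iff₀ h0).2 (by linarith))
  have h2 : ‖s - 1‖ ≤ ‖s‖ + 1 := by simpa using norm_sub_le s 1
  have h3 : ‖s * (s - 1) * fractMellin s‖ ≤ ‖s‖ * (‖s‖ + 1) * 2 := by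
    rw [norm_mul, norm_mul]
    gcongr
  have := norm_sub_le s (s * (s - 1) * fractMellin s)
  nlinarith [norm_nonneg s]

/-- Cauchy's estimate on a circle of radius 1/4, so each derivative costs 1/4 of the half-plane:
starting from Re s ≥ 1/2, two derivatives end at Re s ≥ 1. The factor 16 is 4 from the radius times
2² from comparing `1 + ‖z‖` with `1 + ‖s‖`. -/
lemma norm_deriv_le_of_halfPlane_bound {f : ℂ → ℂ} (hf : Differentiable ℂ f) {a C : ℝ}
    (h : ∀ s : ℂ, a ≤ s.re → ‖f s‖ ≤ C * (1 + ‖s‖) ^ 2) (hC : 0 ≤ C) {s : ℂ} (hs : a + 1 / 4 ≤ s.re) :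
    ‖deriv f s‖ ≤ 16 * C * (1 + ‖s‖) ^ 2 := by
  have := Complex.norm_deriv_le_of_forall_mem_sphere_norm_le (c := s) (R := 1 / 4)
    (C := C * (2 * (1 + ‖s‖)) ^ 2) (by norm_num) hf.diffContOnCl fun z hz => ?_
  · refine this.trans (le_of_eq ?_); ring
  · have hz' : ‖z - s‖ = 1 / 4 := by simpa [dist_eq_norm] using hz
    have h1 := Complex.abs_re_le_norm (z - s)
    rw [hz', Complex.sub_re, abs_le] at h1
    refine (h z (by linarith)).trans ?_
    have h2 : ‖z‖ ≤ ‖s‖ + 1 / 4 := by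
      have := norm_add_le s (z - s)
      rw [hz'] at this; simpa using this
    gcongr
    linarith [norm_nonneg s]

lemma norm_deriv_riemannZeta₁_le {s : ℂ} (hs : 3 / 4 ≤ s.re) :
    ‖deriv riemannZeta₁ s‖ ≤ 48 * (1 + ‖s‖) ^ 2 := by
  have := norm_deriv_le_of_halfPlane_bound differentiable_riemannZeta₁
    (fun s hs => norm_riemannZeta₁_le hs) (by norm_num) (s := s) (by linarith)
  linarith

lemma norm_deriv_deriv_riemannZeta₁_le {s : ℂ} (hs : 1 ≤ s.re) :
    ‖deriv (deriv riemannZeta₁) s‖ ≤ 768 * (1 + ‖s‖) ^ 2 := by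
  have := norm_deriv_le_of_halfPlane_bound
    (differentiable_riemannZeta₁.contDiff (n := 2)).differentiable_deriv_two
    (fun s hs => norm_deriv_riemannZeta₁_le hs) (by norm_num) (s := s) (by linarith)
  linarith

lemma polyGrowth_of_norm_bound {f : ℂ → ℂ} {b C : ℝ} (hC : 0 ≤ C) (hb : 0 ≤ b)
    (h : ∀ s : ℂ, 1 ≤ s.re → ‖f s‖ ≤ C * (1 + ‖s‖) ^ 2) : PolyGrowth b f := by
  refine ⟨C * (2 + b) ^ 2, 2, by positivity, fun s h1 h2 => (h s h1.le).trans ?_⟩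
  rw [mul_assoc, ← mul_pow]
  gcongr
  have := norm_le_of_re_mem (zero_lt_one.trans h1) h2
  linarith [abs_nonneg s.im]

/-! ### Quantitative 3-4-1 lower bound -/

lemma one_le_norm_riemannZeta_product {x : ℝ} (hx : 0 < x) (y : ℝ) :
    1 ≤ ‖riemannZeta (1 + x)‖ ^ 3 * ‖riemannZeta (1 + x + Complex.I * y)‖ ^ 4 *
      ‖riemannZeta (1 + x + 2 * Complex.I * y)‖ := by
  have h := DirichletCharacter.norm_LFunction_product_ge_one (1 : DirichletCharacter ℂ 1) hx y
  have h1 : ((1 : DirichletCharacter ℂ 1) ^ 2) = 1 := one_pow 2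
  rw [DirichletCharacter.LFunctionTrivChar, h1] at h
  simpa [DirichletCharacter.LFunction_modOne_eq] using h

lemma riemannZeta₁_eq_mul {s : ℂ} (hs : s ≠ 1) : riemannZeta₁ s = (s - 1) * riemannZeta s := by
  rw [riemannZeta_eq_inv_sub_mul hs, mul_inv_cancel_left₀ (sub_ne_zero.2 hs)]

lemma riemannZeta₁_ne_zero {s : ℂ} (hs : 1 ≤ s.re) : riemannZeta₁ s ≠ 0 := by
  rcases eq_or_ne s 1 with rfl | h
  · simp
  · rw [riemannZeta₁_eq_mul h]
    exact mul_ne_zero (sub_ne_zero.2 h) (riemannZeta_ne_zero_of_one_le_re hs)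

/-- The `3-4-1` inequality, cleared of the pole. -/
lemma pow_three_le_norm_riemannZeta₁_product {x : ℝ} (hx : 0 < x) {y : ℝ} (hy : 1 ≤ |y|) :
    x ^ 3 ≤ ‖riemannZeta₁ (1 + x)‖ ^ 3 * ‖riemannZeta₁ (1 + x + Complex.I * y)‖ ^ 4 *
      ‖riemannZeta₁ (1 + x + 2 * Complex.I * y)‖ := by
  have h := one_le_norm_riemannZeta_product hx y
  have hne : ∀ c : ℝ, (1 + x + c * Complex.I * y : ℂ) ≠ 1 := fun c hc => by
    have := congrArg Complex.re hc
    simp at this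
    exact hx.ne' this
  have e0 : riemannZeta₁ (1 + x) = x * riemannZeta (1 + x) := by
    rw [riemannZeta₁_eq_mul (by simpa using hne 0)]; ring
  have e1 : riemannZeta₁ (1 + x + Complex.I * y) =
      (x + Complex.I * y) * riemannZeta (1 + x + Complex.I * y) := by
    rw [riemannZeta₁_eq_mul (by simpa using hne 1)]; ring
  have e2 : riemannZeta₁ (1 + x + 2 * Complex.I * y) =
      (x + 2 * Complex.I * y) * riemannZeta (1 + x + 2 * Complex.I * y) := by
    rw [riemannZeta₁_eq_mul (by simpa using hne 2)]; ring
  have n1 : 1 ≤ ‖(x + Complex.I * y : ℂ)‖ := by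
    refine hy.trans ?_
    simpa using Complex.abs_im_le_norm (x + Complex.I * y : ℂ)
  have n2 : 1 ≤ ‖(x + 2 * Complex.I * y : ℂ)‖ := by
    have := Complex.abs_im_le_norm (x + 2 * Complex.I * y : ℂ)
    simp [abs_mul] at this
    linarith
  rw [e0, e1, e2, norm_mul, norm_mul, norm_mul, Complex.norm_real, Real.norm_of_nonneg hx.le]
  have hp : x ^ 3 ≤ x ^ 3 * ‖(x + Complex.I * y : ℂ)‖ ^ 4 * ‖(x + 2 * Complex.I * y : ℂ)‖ := by
    have : 1 ≤ ‖(x + Complex.I * y : ℂ)‖ ^ 4 * ‖(x + 2 * Complex.I * y : ℂ)‖ :=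
      one_le_mul_of_one_le_of_one_le (one_le_pow₀ n1) n2
    rw [mul_assoc]
    exact le_mul_of_one_le_right (by positivity) this
  calc x ^ 3 ≤ (x ^ 3 * ‖(x + Complex.I * y : ℂ)‖ ^ 4 * ‖(x + 2 * Complex.I * y : ℂ)‖) * 1 := by
        rwa [mul_one]
    _ ≤ (x ^ 3 * ‖(x + Complex.I * y : ℂ)‖ ^ 4 * ‖(x + 2 * Complex.I * y : ℂ)‖) *
        (‖riemannZeta (1 + x)‖ ^ 3 * ‖riemannZeta (1 + x + Complex.I * y)‖ ^ 4 *
      ‖riemannZeta (1 + x + 2 * Complex.I * y)‖) := by gcongr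
    _ = _ := by ring

lemma norm_sub_le_of_horizontal {B : ℝ} {σ t η : ℝ} (hη : 0 ≤ η)
    (hB : ∀ x : ℝ, σ ≤ x → x ≤ σ + η → ‖deriv riemannZeta₁ (x + Complex.I * t)‖ ≤ B) :
    ‖riemannZeta₁ ((σ + η : ℝ) + Complex.I * t) - riemannZeta₁ (σ + Complex.I * t)‖ ≤ B * η := by
  have h : ∀ x ∈ Icc σ (σ + η), HasDerivWithinAt
      (fun x : ℝ => riemannZeta₁ (x + Complex.I * t)) (deriv riemannZeta₁ (x + Complex.I * t))
      (Icc σ (σ + η)) x := by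
    intro x _
    have h1 : HasDerivAt (fun z : ℂ => riemannZeta₁ (z + Complex.I * t))
        (deriv riemannZeta₁ (x + Complex.I * t)) (x : ℂ) := by
      simpa using (differentiable_riemannZeta₁ _).hasDerivAt.comp_add_const (x : ℂ) (Complex.I * t)
    exact h1.comp_ofReal.hasDerivWithinAt
  have := norm_image_sub_le_of_norm_deriv_le_segment' h (C := B)
    (fun x hx => hB x hx.1 hx.2.le) (σ + η) (right_mem_Icc.2 (by linarith))
  simpa using this

/-- The 3-4-1 inequality is applied at the point shifted right by `θ ^ 4`, where it gives a lower
bound of order θ³/T; the mean value inequality carries this back to `s` at a cost of order T² θ⁴,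
which is smaller for small `θ`. -/
lemma exists_lower_bound_riemannZeta₁_of_one_le_abs_im :
    ∃ (c : ℝ) (A : ℕ), 0 < c ∧ ∀ s : ℂ, 1 < s.re → s.re ≤ 2 → 1 ≤ |s.im| →
      c ≤ ‖riemannZeta₁ s‖ * (1 + |s.im|) ^ A := by
  -- all relevant points have real part in `(1, 3]` and imaginary part at most `2 |im s|`
  obtain ⟨D, hD1, hD⟩ : ∃ D : ℝ, 1 ≤ D ∧ ∀ z : ℂ, ∀ T : ℝ, 1 ≤ T → 1 ≤ z.re → z.re ≤ 3 →
      |z.im| ≤ 2 * T → ‖riemannZeta₁ z‖ ≤ D * T ^ 2 ∧ ‖deriv riemannZeta₁ z‖ ≤ D * T ^ 2 := by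
    refine ⟨48 * 6 ^ 2, by norm_num, fun z T hT h1 h3 him => ?_⟩
    have hz : 1 + ‖z‖ ≤ 6 * T := by
      have := Complex.norm_le_abs_re_add_abs_im z
      rw [abs_of_nonneg (by linarith)] at this
      linarith
    have hz2 : (1 + ‖z‖) ^ 2 ≤ 6 ^ 2 * T ^ 2 := by
      rw [← mul_pow]; gcongr
    have a := norm_riemannZeta₁_le (s := z) (by linarith)
    have b := norm_deriv_riemannZeta₁_le (s := z) (by linarith)
    constructor <;> nlinarith [sq_nonneg T]
  set c : ℝ := 1 / D with hc
  have hcpos : 0 < c := by positivity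
  have hcle : c ≤ 1 := by rw [hc]; exact (div_le_one (by linarith)).2 hD1
  refine ⟨c * (c / (2 * D)) ^ 3 / 2, 10, by positivity, fun s h1 h2 ht => ?_⟩
  set T : ℝ := 1 + |s.im| with hT
  have hT1 : 1 ≤ T := by simp [hT]
  -- This choice makes the cost `D * T ^ 2 * θ ^ 4` of the shift exactly half of the lower bound `c
  -- * θ ^ 3 / T`. What remains is of order T^{-10}, whence the exponent `10`.
  set θ : ℝ := c / (2 * D * T ^ 3) with hθ
  have hθpos : 0 < θ := by positivity
  have hθ1 : θ ≤ 1 := by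
    rw [hθ, div_le_one (by positivity)]
    have : 1 ≤ T ^ 3 := one_le_pow₀ hT1
    nlinarith
  have hη1 : θ ^ 4 ≤ 1 := pow_le_one₀ hθpos.le hθ1
  set x : ℝ := s.re - 1 + θ ^ 4 with hx
  have hxpos : θ ^ 4 ≤ x := by rw [hx]; linarith
  have hx2 : x ≤ 2 := by rw [hx]; linarith
  have hx0 : 0 < x := lt_of_lt_of_le (by positivity) hxpos
  have key := pow_three_le_norm_riemannZeta₁_product hx0 ht
  have b0 : ‖riemannZeta₁ (1 + x)‖ ≤ D := by
    have := (hD (1 + x) 1 le_rfl (by simp; linarith) (by simp; linarith) (by simp)).1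
    simpa using this
  have b2 : ‖riemannZeta₁ (1 + x + 2 * Complex.I * s.im)‖ ≤ D * T ^ 2 :=
    (hD _ T hT1 (by simp; linarith) (by simp; linarith) (by simp [abs_mul, hT])).1
  set h := ‖riemannZeta₁ (1 + x + Complex.I * s.im)‖ with hh
  have hlow : c * θ ^ 3 / T ≤ h := by
    have h4 : (c * θ ^ 3 / T) ^ 4 ≤ h ^ 4 := by
      have k1 : (θ ^ 4) ^ 3 ≤ D ^ 3 * h ^ 4 * (D * T ^ 2) :=
        (pow_le_pow_left₀ (by positivity) hxpos 3).trans (key.trans (by gcongr))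
      rw [div_pow, div_le_iff₀ (by positivity), mul_pow, hc, div_pow, div_mul_eq_mul_div, one_pow,
        one_mul, div_le_iff₀ (by positivity)]
      calc (θ ^ 3) ^ 4 = (θ ^ 4) ^ 3 := by ring
        _ ≤ D ^ 3 * h ^ 4 * (D * T ^ 2) := k1
        -- Weakening T² to T⁴ makes the right side a fourth power, so that roots can be taken.
        _ ≤ D ^ 3 * h ^ 4 * (D * T ^ 4) := by gcongr; norm_num
        _ = _ := by ring
    exact le_of_pow_le_pow_left₀ (by norm_num) (norm_nonneg _) h4
  have hdiff := norm_sub_le_of_horizontal (σ := s.re) (t := s.im) (η := θ ^ 4) (B := D * T ^ 2)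
    (by positivity) fun x hx1 hx2 => (hD _ T hT1 (by simp; linarith) (by simp; linarith)
      (by simp [hT]; linarith [abs_nonneg s.im])).2
  have e1 : ((s.re + θ ^ 4 : ℝ) + Complex.I * s.im : ℂ) = 1 + x + Complex.I * s.im := by
    simp [hx]; ring
  have e2 : (s.re + Complex.I * s.im : ℂ) = s := by rw [mul_comm]; exact Complex.re_add_im s
  rw [e1, e2] at hdiff
  have h5 : h - D * T ^ 2 * θ ^ 4 ≤ ‖riemannZeta₁ s‖ := by
    have := norm_sub_norm_le (riemannZeta₁ (1 + x + Complex.I * s.im)) (riemannZeta₁ s)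
    linarith
  have h6 : D * T ^ 2 * θ ^ 4 = c * θ ^ 3 / T / 2 := by
    rw [show θ ^ 4 = θ ^ 3 * θ by ring]
    nth_rewrite 2 [hθ]
    field_simp
  have h7 : c * θ ^ 3 / T / 2 ≤ ‖riemannZeta₁ s‖ := by linarith
  have h8 : c * θ ^ 3 / T / 2 * T ^ 10 = c * (c / (2 * D)) ^ 3 / 2 := by
    rw [hθ]
    field_simp
  rw [← h8]
  gcongr

/-- The remaining rectangle |Im s| ≤ 1 is compact and, with the pole removed, the function is
continuous and nonvanishing on it. -/
lemma exists_lower_bound_riemannZeta₁ :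
    ∃ (c : ℝ) (A : ℕ), 0 < c ∧ ∀ s : ℂ, 1 < s.re → s.re ≤ 2 →
      c ≤ ‖riemannZeta₁ s‖ * (1 + |s.im|) ^ A := by
  obtain ⟨c, A, hc, h⟩ := exists_lower_bound_riemannZeta₁_of_one_le_abs_im
  have hK : IsCompact (Icc (1 : ℝ) 2 ×ℂ Icc (-1 : ℝ) 1) := isCompact_Icc.reProdIm isCompact_Icc
  obtain ⟨z, hz, hmin⟩ := hK.exists_isMinOn ⟨1, by simp [Complex.mem_reProdIm]⟩
    differentiable_riemannZeta₁.continuous.norm.continuousOn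
  have hz1 : 1 ≤ z.re := (Complex.mem_reProdIm.1 hz).1.1
  refine ⟨min c ‖riemannZeta₁ z‖, A, lt_min hc (norm_pos_iff.2 (riemannZeta₁_ne_zero hz1)),
    fun s h1 h2 => ?_⟩
  rcases le_total 1 |s.im| with ht | ht
  · exact (min_le_left _ _).trans (h s h1 h2 ht)
  · refine (min_le_right _ _).trans ?_
    have : ‖riemannZeta₁ z‖ ≤ ‖riemannZeta₁ s‖ :=
      hmin (Complex.mem_reProdIm.2 ⟨⟨h1.le, h2⟩, abs_le.1 ht⟩)
    exact this.trans (le_mul_of_one_le_right (norm_nonneg _) (one_le_pow₀ (by simp)))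

lemma polyGrowth_inv_riemannZeta₁ : PolyGrowth 2 fun s => (riemannZeta₁ s)⁻¹ := by
  obtain ⟨c, A, hc, h⟩ := exists_lower_bound_riemannZeta₁
  refine ⟨1 / c, A, by positivity, fun s h1 h2 => ?_⟩
  have h0 : 0 < ‖riemannZeta₁ s‖ := norm_pos_iff.2 (riemannZeta₁_ne_zero h1.le)
  rw [norm_inv, inv_le_iff_one_le_mul₀ h0, one_div, ← div_eq_inv_mul, div_mul_eq_mul_div,
    one_le_div hc, mul_comm]
  exact h s h1 h2

/-! ### The reciprocal of ζ and its derivatives -/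

/-- `1 / ζ` written without the removable singularity at `1`. -/
noncomputable def zetaInv (s : ℂ) : ℂ := (s - 1) * (riemannZeta₁ s)⁻¹

/-- The derivative of `zetaInv`, arranged as sums and products of factors of known growth so that
the closure rules of `PolyGrowth` apply to it literally; likewise `zetaInv''`. -/
noncomputable def zetaInv' (s : ℂ) : ℂ :=
  (riemannZeta₁ s)⁻¹ + (s - 1) * (-1 * deriv riemannZeta₁ s * ((riemannZeta₁ s)⁻¹ * (riemannZeta₁ s)⁻¹))

noncomputable def zetaInv'' (s : ℂ) : ℂ :=
  -2 * deriv riemannZeta₁ s * ((riemannZeta₁ s)⁻¹ * (riemannZeta₁ s)⁻¹) +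
    (s - 1) * (-1 * deriv (deriv riemannZeta₁) s * ((riemannZeta₁ s)⁻¹ * (riemannZeta₁ s)⁻¹) +
      2 * (deriv riemannZeta₁ s * deriv riemannZeta₁ s) *
        ((riemannZeta₁ s)⁻¹ * (riemannZeta₁ s)⁻¹ * (riemannZeta₁ s)⁻¹))

lemma zetaInv_eq {s : ℂ} (hs : s ≠ 1) : zetaInv s = (riemannZeta s)⁻¹ := by
  rw [zetaInv, riemannZeta₁_eq_mul hs, mul_inv, mul_inv_cancel_left₀ (sub_ne_zero.2 hs)]

lemma hasDerivAt_zetaInv {s : ℂ} (hs : 1 ≤ s.re) : HasDerivAt zetaInv (zetaInv' s) s := by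
  have h0 := riemannZeta₁_ne_zero hs
  have h1 := (differentiable_riemannZeta₁ s).hasDerivAt
  have h2 : HasDerivAt zetaInv _ s := ((hasDerivAt_id s).sub_const 1).mul (h1.inv h0)
  refine h2.congr_deriv ?_
  simp only [zetaInv', id]
  field_simp

lemma hasDerivAt_zetaInv' {s : ℂ} (hs : 1 ≤ s.re) : HasDerivAt zetaInv' (zetaInv'' s) s := by
  have h0 := riemannZeta₁_ne_zero hs
  have h1 := (differentiable_riemannZeta₁ s).hasDerivAt
  have h2 := ((differentiable_riemannZeta₁.contDiff (n := 2)).differentiable_deriv_two s).hasDerivAt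
  have h3 : HasDerivAt zetaInv' _ s := (h1.inv h0).add (((hasDerivAt_id s).sub_const 1).mul
    ((h2.const_mul (-1)).mul ((h1.inv h0).mul (h1.inv h0))))
  refine h3.congr_deriv ?_
  simp only [zetaInv'', id, Pi.inv_apply]
  field_simp
  ring

lemma polyGrowth_riemannZeta₁_deriv : PolyGrowth 2 (deriv riemannZeta₁) :=
  polyGrowth_of_norm_bound (by norm_num) zero_le_two
    fun s hs => norm_deriv_riemannZeta₁_le (by linarith)

lemma polyGrowth_riemannZeta₁_deriv_deriv : PolyGrowth 2 (deriv (deriv riemannZeta₁)) :=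
  polyGrowth_of_norm_bound (by norm_num) zero_le_two
    fun s hs => norm_deriv_deriv_riemannZeta₁_le hs

lemma polyGrowth_sub_one : PolyGrowth 2 fun s => s - 1 :=
  (PolyGrowth.id 2 zero_le_two).add (PolyGrowth.const 2 (-1))

lemma polyGrowth_zetaInv : PolyGrowth 2 zetaInv :=
  polyGrowth_sub_one.mul polyGrowth_inv_riemannZeta₁

lemma polyGrowth_zetaInv' : PolyGrowth 2 zetaInv' :=
  have I := polyGrowth_inv_riemannZeta₁
  I.add (polyGrowth_sub_one.mul (((PolyGrowth.const 2 (-1)).mul polyGrowth_riemannZeta₁_deriv).mul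
    (I.mul I)))

lemma polyGrowth_zetaInv'' : PolyGrowth 2 zetaInv'' :=
  have I := polyGrowth_inv_riemannZeta₁
  have D := polyGrowth_riemannZeta₁_deriv
  (((PolyGrowth.const 2 (-2)).mul D).mul (I.mul I)).add
    (polyGrowth_sub_one.mul ((((PolyGrowth.const 2 (-1)).mul
      polyGrowth_riemannZeta₁_deriv_deriv).mul (I.mul I)).add
      (((PolyGrowth.const 2 2).mul (D.mul D)).mul ((I.mul I).mul I))))

/-! ### Fourier decay and smoothed Möbius sums -/

/-- The transform of F'' is (2πiv)² times that of F, each transform is bounded by an L¹ norm, and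
(2π)² ≥ 1. -/
lemma norm_fourier_mul_one_add_sq_le {F F' F'' : ℝ → ℂ} (h1 : ∀ x, HasDerivAt F (F' x) x)
    (h2 : ∀ x, HasDerivAt F' (F'' x) x) (i0 : Integrable F) (i1 : Integrable F')
    (i2 : Integrable F'') (v : ℝ) :
    ‖𝓕 F v‖ * (1 + v ^ 2) ≤ (∫ x, ‖F x‖) + ∫ x, ‖F'' x‖ := by
  have d1 : deriv F = F' := funext fun x => (h1 x).deriv
  have d2 : deriv F' = F'' := funext fun x => (h2 x).deriv
  have e1 := Real.fourier_deriv i0 (fun x => (h1 x).differentiableAt) (d1 ▸ i1)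
  have e2 := Real.fourier_deriv i1 (fun x => (h2 x).differentiableAt) (d2 ▸ i2)
  rw [d1] at e1
  rw [d2, e1] at e2
  have b : ∀ (f : ℝ → ℂ), ‖𝓕 f v‖ ≤ ∫ x, ‖f x‖ := fun f =>
    VectorFourier.norm_fourierIntegral_le_integral_norm _ _ _ _ _
  have b0 := b F
  have b2 := b F''
  rw [congrFun e2 v] at b2
  have n1 : ‖(2 * Real.pi * Complex.I * v : ℂ)‖ = 2 * Real.pi * |v| := by
    simp [abs_of_pos Real.pi_pos]
  simp only [smul_eq_mul, norm_mul] at b2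
  rw [← norm_mul, ← norm_mul, ← norm_mul, n1] at b2
  have : v ^ 2 * ‖𝓕 F v‖ ≤ 2 * Real.pi * |v| * (2 * Real.pi * |v| * ‖𝓕 F v‖) := by
    have hp : (1 : ℝ) ≤ (2 * Real.pi) * (2 * Real.pi) := by nlinarith [Real.pi_gt_three]
    have : v ^ 2 = |v| * |v| := by rw [← sq, sq_abs]
    rw [this]
    have h0 : 0 ≤ |v| * |v| * ‖𝓕 F v‖ := by positivity
    nlinarith
  linarith

/-- The vertical line of abscissa `1 + ε`, in the normalisation of the Fourier transform. -/
noncomputable def vline (ε ξ : ℝ) : ℂ := (1 + ε : ℝ) + (2 * Real.pi * ξ : ℝ) * Complex.I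

lemma vline_re (ε ξ : ℝ) : (vline ε ξ).re = 1 + ε := by simp [vline]

lemma vline_im (ε ξ : ℝ) : (vline ε ξ).im = 2 * Real.pi * ξ := by simp [vline]

lemma hasDerivAt_vline (ε ξ : ℝ) :
    HasDerivAt (vline ε) (2 * Real.pi * Complex.I) ξ := by
  have h : HasDerivAt (fun x : ℝ => (2 * Real.pi * x : ℝ)) (2 * Real.pi) ξ := by
    simpa using (hasDerivAt_id ξ).const_mul (2 * Real.pi)
  have h2 : HasDerivAt (vline ε) _ ξ :=
    (h.ofReal_comp.mul_const Complex.I).const_add (((1 + ε : ℝ)) : ℂ)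
  exact h2.congr_deriv (by simp)

lemma continuous_vline (ε : ℝ) : Continuous (vline ε) :=
  continuous_iff_continuousAt.2 fun ξ => (hasDerivAt_vline ε ξ).continuousAt

/-- Schwartz decay beats polynomial growth; the point is that one majorant serves every `ε` in (0,
1]. -/
lemma PolyGrowth.exists_integrable_bound {P : ℂ → ℂ} (hP : PolyGrowth 2 P) (g : 𝓢(ℝ, ℂ)) :
    ∃ D : ℝ → ℝ, Integrable D ∧ ∀ ε : ℝ, 0 < ε → ε ≤ 1 → ∀ ξ, ‖g ξ * P (vline ε ξ)‖ ≤ D ξ := by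
  obtain ⟨C, A, hC, h⟩ := hP
  refine ⟨fun ξ => C * 2 ^ (A - 1) * ‖g ξ‖ + C * 2 ^ (A - 1) * (2 * Real.pi) ^ A * (‖ξ‖ ^ A * ‖g ξ‖),
    ?_, fun ε h0 h1 ξ => ?_⟩
  · exact (g.integrable.norm.const_mul _).add ((g.integrable_pow_mul volume A).const_mul _)
  · rw [norm_mul]
    have b := h (vline ε ξ) (by rw [vline_re]; linarith) (by rw [vline_re]; linarith)
    rw [vline_im] at b
    have b2 : (1 + |2 * Real.pi * ξ|) ^ A ≤ 2 ^ (A - 1) * (1 ^ A + |2 * Real.pi * ξ| ^ A) :=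
      add_pow_le zero_le_one (abs_nonneg _) A
    rw [abs_mul, abs_of_pos (by positivity : 0 < 2 * Real.pi), mul_pow, one_pow] at b2
    rw [abs_mul, abs_of_pos (by positivity : 0 < 2 * Real.pi)] at b
    calc ‖g ξ‖ * ‖P (vline ε ξ)‖
        ≤ ‖g ξ‖ * (C * (2 ^ (A - 1) * (1 + (2 * Real.pi) ^ A * |ξ| ^ A))) := by
          gcongr
          exact b.trans (by gcongr)
      _ = _ := by simp only [Real.norm_eq_abs ξ]; ring

/-- The smoothed Möbius sum `∑ μ(n) n^{-1-ε} k(v - log n)`. -/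
noncomputable def smoothedMoebius (k : ℝ → ℂ) (ε v : ℝ) : ℂ :=
  ∑' n : ℕ, (ArithmeticFunction.moebius n : ℂ) * ((n : ℝ) ^ (-(1 + ε)) : ℝ) * k (v - Real.log n)

/-- The product and its second derivative are dominated by integrable functions independent of `ε`,
so the quadratic decay holds with a uniform constant. -/
lemma exists_fourierInv_bound (g : 𝓢(ℝ, ℂ)) : ∃ C : ℝ, 0 ≤ C ∧ ∀ ε : ℝ, 0 < ε → ε ≤ 1 → ∀ v : ℝ,
    ‖𝓕⁻ (fun ξ => g ξ * zetaInv (vline ε ξ)) v‖ ≤ C / (1 + v ^ 2) := by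
  set g' := SchwartzMap.derivCLM ℂ ℂ g with hg'
  set g'' := SchwartzMap.derivCLM ℂ ℂ g' with hg''
  have dg : ∀ x, HasDerivAt g (g' x) x := fun x => by
    rw [hg', SchwartzMap.derivCLM_apply]; exact g.hasDerivAt x
  have dg' : ∀ x, HasDerivAt g' (g'' x) x := fun x => by
    rw [hg'', SchwartzMap.derivCLM_apply]; exact g'.hasDerivAt x
  set c : ℂ := 2 * Real.pi * Complex.I with hc
  have pc := PolyGrowth.const 2 c
  obtain ⟨D0, iD0, b0⟩ := polyGrowth_zetaInv.exists_integrable_bound g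
  obtain ⟨D1, iD1, b1⟩ := polyGrowth_zetaInv.exists_integrable_bound g'
  obtain ⟨D1', iD1', b1'⟩ := (polyGrowth_zetaInv'.mul pc).exists_integrable_bound g
  obtain ⟨D2, iD2, b2⟩ := polyGrowth_zetaInv.exists_integrable_bound g''
  obtain ⟨D2', iD2', b2'⟩ := (polyGrowth_zetaInv'.mul pc).exists_integrable_bound g'
  obtain ⟨D2'', iD2'', b2''⟩ := ((polyGrowth_zetaInv''.mul pc).mul pc).exists_integrable_bound g
  have D0nn : ∀ x, 0 ≤ D0 x := fun x => (norm_nonneg _).trans (b0 1 one_pos le_rfl x)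
  have D2nn : ∀ x, 0 ≤ D2 x := fun x => (norm_nonneg _).trans (b2 1 one_pos le_rfl x)
  have D2'nn : ∀ x, 0 ≤ D2' x := fun x => (norm_nonneg _).trans (b2' 1 one_pos le_rfl x)
  have D2''nn : ∀ x, 0 ≤ D2'' x := fun x => (norm_nonneg _).trans (b2'' 1 one_pos le_rfl x)
  set E : ℝ → ℝ := fun x => (D2 x + D2' x) + (D2' x + D2'' x) with hE
  have iE : Integrable E := (iD2.add iD2').add (iD2'.add iD2'')
  have Enn : ∀ x, 0 ≤ E x := fun x =>
    add_nonneg (add_nonneg (D2nn x) (D2'nn x)) (add_nonneg (D2'nn x) (D2''nn x))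
  refine ⟨(∫ x, D0 x) + ∫ x, E x, add_nonneg (integral_nonneg D0nn) (integral_nonneg Enn),
    fun ε h0 h1 v => ?_⟩
  have hre : ∀ ξ, 1 ≤ (vline ε ξ).re := fun ξ => by rw [vline_re]; linarith
  have dz : ∀ ξ, HasDerivAt (fun ξ => zetaInv (vline ε ξ)) (zetaInv' (vline ε ξ) * c) ξ :=
    fun ξ => (hasDerivAt_zetaInv (hre ξ)).comp ξ (hasDerivAt_vline ε ξ)
  have dz' : ∀ ξ, HasDerivAt (fun ξ => zetaInv' (vline ε ξ) * c) (zetaInv'' (vline ε ξ) * c * c) ξ :=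
    fun ξ => ((hasDerivAt_zetaInv' (hre ξ)).comp ξ (hasDerivAt_vline ε ξ)).mul_const c
  have hF : ∀ ξ, HasDerivAt (fun ξ => g ξ * zetaInv (vline ε ξ))
      (g' ξ * zetaInv (vline ε ξ) + g ξ * (zetaInv' (vline ε ξ) * c)) ξ :=
    fun ξ => (dg ξ).mul (dz ξ)
  have hF' : ∀ ξ, HasDerivAt
      (fun ξ => g' ξ * zetaInv (vline ε ξ) + g ξ * (zetaInv' (vline ε ξ) * c))
      ((g'' ξ * zetaInv (vline ε ξ) + g' ξ * (zetaInv' (vline ε ξ) * c)) +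
        (g' ξ * (zetaInv' (vline ε ξ) * c) + g ξ * (zetaInv'' (vline ε ξ) * c * c))) ξ :=
    fun ξ => ((dg' ξ).mul (dz ξ)).add ((dg ξ).mul (dz' ξ))
  have cont : ∀ {f f' : ℝ → ℂ}, (∀ ξ, HasDerivAt f (f' ξ) ξ) → Continuous f := fun h =>
    continuous_iff_continuousAt.2 fun ξ => (h ξ).continuousAt
  -- Continuity of the second derivative is needed only for the measurability of the second
  -- derivative of the product.
  have c2 : Continuous fun ξ => zetaInv'' (vline ε ξ) := by
    refine continuous_iff_continuousAt.2 fun ξ =>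
      ContinuousAt.comp (g := zetaInv'') ?_ (continuous_vline ε).continuousAt
    have hz := riemannZeta₁_ne_zero (hre ξ)
    have k0 : ContinuousAt riemannZeta₁ (vline ε ξ) :=
      differentiable_riemannZeta₁.continuous.continuousAt
    have k1 : ContinuousAt (deriv riemannZeta₁) (vline ε ξ) :=
      (differentiable_riemannZeta₁.contDiff (n := 2)).differentiable_deriv_two.continuous.continuousAt
    have k2 : ContinuousAt (deriv (deriv riemannZeta₁)) (vline ε ξ) := by
      have := (differentiable_riemannZeta₁.contDiff (n := 2)).continuous_iteratedDeriv 2 le_rfl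
      rw [iteratedDeriv_succ, iteratedDeriv_one] at this
      exact this.continuousAt
    have k3 := k0.inv₀ hz
    unfold zetaInv''
    exact ((continuousAt_const.mul k1).mul (k3.mul k3)).add
      ((continuousAt_id.sub continuousAt_const).mul (((continuousAt_const.mul k2).mul (k3.mul k3)).add
        ((continuousAt_const.mul (k1.mul k1)).mul ((k3.mul k3).mul k3))))
  have i0 : Integrable (fun ξ => g ξ * zetaInv (vline ε ξ)) :=
    iD0.mono' (cont hF).aestronglyMeasurable (ae_of_all _ (b0 ε h0 h1))
  have i1 : Integrable (fun ξ => g' ξ * zetaInv (vline ε ξ) + g ξ * (zetaInv' (vline ε ξ) * c)) :=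
    (iD1.add iD1').mono' (cont hF').aestronglyMeasurable
      (ae_of_all _ fun x => (norm_add_le _ _).trans (add_le_add (b1 ε h0 h1 x) (b1' ε h0 h1 x)))
  have bE : ∀ ξ, ‖(g'' ξ * zetaInv (vline ε ξ) + g' ξ * (zetaInv' (vline ε ξ) * c)) +
        (g' ξ * (zetaInv' (vline ε ξ) * c) + g ξ * (zetaInv'' (vline ε ξ) * c * c))‖ ≤ E ξ :=
    fun x => (norm_add_le _ _).trans (add_le_add
      ((norm_add_le _ _).trans (add_le_add (b2 ε h0 h1 x) (b2' ε h0 h1 x)))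
      ((norm_add_le _ _).trans (add_le_add (b2' ε h0 h1 x) (b2'' ε h0 h1 x))))
  have i2 : Integrable (fun ξ => (g'' ξ * zetaInv (vline ε ξ) + g' ξ * (zetaInv' (vline ε ξ) * c)) +
        (g' ξ * (zetaInv' (vline ε ξ) * c) + g ξ * (zetaInv'' (vline ε ξ) * c * c))) := by
    refine iE.mono' (Continuous.aestronglyMeasurable ?_) (ae_of_all _ bE)
    exact ((g''.continuous.mul (cont dz)).add (g'.continuous.mul (cont dz'))).add
      ((g'.continuous.mul (cont dz')).add (g.continuous.mul ((c2.mul continuous_const).mul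
        continuous_const)))
  have key := norm_fourier_mul_one_add_sq_le hF hF' i0 i1 i2 (-v)
  rw [Real.fourierInv_eq_fourier_neg, le_div_iff₀ (by positivity)]
  rw [neg_sq] at key
  exact key.trans (add_le_add (integral_mono i0.norm iD0 (b0 ε h0 h1)) (integral_mono i2.norm iE bE))

lemma natCast_cpow_neg_vline {n : ℕ} (hn : n ≠ 0) (ε ξ : ℝ) :
    (n : ℂ) ^ (-vline ε ξ) = ((n : ℝ) ^ (-(1 + ε)) : ℝ) *
      Complex.exp ((2 * Real.pi * (ξ * -Real.log n) : ℝ) * Complex.I) := by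
  have hn' : (n : ℂ) ≠ 0 := by exact_mod_cast hn
  have hn0 : (0 : ℝ) < n := by positivity
  rw [Complex.cpow_def_of_ne_zero hn', Real.rpow_def_of_pos hn0, Complex.ofReal_exp,
    ← Complex.exp_add, ← Complex.natCast_log]
  congr 1
  simp [vline]
  ring

/-- Write each translate of `k` by Fourier inversion: the shift by log n becomes the oscillating
part of n^{-s} on the vertical line, and ∑ μ(n) n^{-s} = 1/ζ(s). Since ε > 0, sum and integral may
be exchanged absolutely. -/
lemma smoothedMoebius_eq_fourierInv (k : 𝓢(ℝ, ℂ)) {ε : ℝ} (hε : 0 < ε) (v : ℝ) :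
    smoothedMoebius k ε v = 𝓕⁻ (fun ξ => (𝓕 k) ξ * zetaInv (vline ε ξ)) v := by
  have hk : ∀ x : ℝ, k x = ∫ ξ : ℝ, Complex.exp ((2 * Real.pi * (ξ * x) : ℝ) * Complex.I) * (𝓕 k) ξ := by
    intro x
    conv_lhs => rw [← FourierTransform.fourierInv_fourier_eq (F := 𝓢(ℝ, ℂ)) k]
    rw [SchwartzMap.fourierInv_coe, Real.fourierInv_eq']
    simp [mul_comm]
  set F : ℕ → ℝ → ℂ := fun n ξ => Complex.exp ((2 * Real.pi * (ξ * v) : ℝ) * Complex.I) *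
    ((𝓕 k) ξ * LSeries.term (fun n => (ArithmeticFunction.moebius n : ℂ)) (vline ε ξ) n) with hF
  have hnorm : ∀ n ξ, ‖F n ξ‖ ≤ (n : ℝ) ^ (-(1 + ε)) * ‖(𝓕 k) ξ‖ := by
    intro n ξ
    rcases eq_or_ne n 0 with rfl | hn
    · simp only [hF, LSeries.term_zero, mul_zero, norm_zero]; positivity
    · simp only [hF, norm_mul, Complex.norm_exp_ofReal_mul_I, one_mul]
      rw [LSeries.norm_term_eq, if_neg hn, vline_re, mul_comm, Real.rpow_neg (by positivity),
        ← one_div]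
      have h1 : ‖(ArithmeticFunction.moebius n : ℂ)‖ ≤ 1 := by
        rw [Complex.norm_intCast]
        exact_mod_cast ArithmeticFunction.abs_moebius_le_one
      exact mul_le_mul_of_nonneg_right (div_le_div_of_nonneg_right h1
        (Real.rpow_nonneg n.cast_nonneg (1 + ε)))
        (norm_nonneg ((𝓕 k) ξ))
  have hFeq : ∀ n, n ≠ 0 → ∀ ξ, F n ξ = (ArithmeticFunction.moebius n : ℂ) * ((n : ℝ) ^ (-(1 + ε)) : ℝ) *
      (Complex.exp ((2 * Real.pi * (ξ * (v - Real.log n)) : ℝ) * Complex.I) * (𝓕 k) ξ) := by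
    intro n hn ξ
    have e : Complex.exp ((2 * Real.pi * (ξ * (v - Real.log n)) : ℝ) * Complex.I) =
        Complex.exp ((2 * Real.pi * (ξ * v) : ℝ) * Complex.I) *
        Complex.exp ((2 * Real.pi * (ξ * -Real.log n) : ℝ) * Complex.I) := by
      rw [← Complex.exp_add]; congr 1; push_cast; ring
    simp only [hF]
    rw [LSeries.term_of_ne_zero hn, div_eq_mul_inv, ← Complex.cpow_neg, natCast_cpow_neg_vline hn, e]
    ring
  have hint : ∀ n, ∫ ξ, F n ξ = (ArithmeticFunction.moebius n : ℂ) * ((n : ℝ) ^ (-(1 + ε)) : ℝ) *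
      k (v - Real.log n) := by
    intro n
    rcases eq_or_ne n 0 with rfl | hn
    · simp [hF]
    · simp_rw [hFeq n hn]
      rw [integral_const_mul, ← hk]
  have hFi : ∀ n, Integrable (F n) := by
    intro n
    refine ((𝓕 k).integrable.norm.const_mul ((n : ℝ) ^ (-(1 + ε)))).mono' ?_ (ae_of_all _ (hnorm n))
    rcases eq_or_ne n 0 with rfl | hn
    · simp only [hF, LSeries.term_zero, mul_zero]; exact aestronglyMeasurable_const
    · rw [funext (hFeq n hn)]
      refine (Continuous.mul continuous_const (Continuous.mul ?_ (𝓕 k).continuous)).aestronglyMeasurable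
      fun_prop
  have hsum : Summable fun n => ∫ ξ, ‖F n ξ‖ := by
    have : Summable fun n : ℕ => (n : ℝ) ^ (-(1 + ε)) * ∫ ξ, ‖(𝓕 k) ξ‖ :=
      (Real.summable_nat_rpow.2 (by linarith)).mul_right _
    refine this.of_nonneg_of_le (fun n => integral_nonneg fun ξ => norm_nonneg _) fun n => ?_
    rw [← integral_const_mul]
    exact integral_mono (hFi n).norm ((𝓕 k).integrable.norm.const_mul _) (hnorm n)
  have key := integral_tsum_of_summable_integral_norm hFi hsum
  simp_rw [hint] at key
  rw [smoothedMoebius, key, Real.fourierInv_eq']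
  refine integral_congr_ae (ae_of_all _ fun ξ => ?_)
  have hs : 1 < (vline ε ξ).re := by rw [vline_re]; linarith
  have hs1 : vline ε ξ ≠ 1 := fun h => by simp [h] at hs
  have hL : ∑' n, LSeries.term (fun n => (ArithmeticFunction.moebius n : ℂ)) (vline ε ξ) n =
      zetaInv (vline ε ξ) := by
    rw [zetaInv_eq hs1]
    have := LSeries_one_mul_Lseries_moebius hs
    rw [LSeries_one_eq_riemannZeta hs] at this
    exact eq_inv_of_mul_eq_one_right this
  simp only [hF]
  rw [tsum_mul_left, tsum_mul_left, hL]
  simp [mul_comm v]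

/-- Uniform decay of the smoothed Möbius sums: a smooth form of the prime number theorem. -/
theorem exists_smoothedMoebius_bound (k : 𝓢(ℝ, ℂ)) : ∃ C : ℝ, 0 ≤ C ∧
    ∀ ε : ℝ, 0 < ε → ε ≤ 1 → ∀ v : ℝ, ‖smoothedMoebius k ε v‖ ≤ C / (1 + v ^ 2) := by
  obtain ⟨C, hC, h⟩ := exists_fourierInv_bound (𝓕 k)
  exact ⟨C, hC, fun ε h0 h1 v => by rw [smoothedMoebius_eq_fourierInv k h0]; exact h ε h0 h1 v⟩

/-! ### The kernel of the Riesz function is Schwartz -/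

/-- The functions e^u Q(e^u) exp(-e^{2u}) with Q a polynomial are stable under differentiation, so
every derivative of the kernel is of this shape. -/
lemma hasDerivAt_exp_mul_eval_mul_exp (Q : Polynomial ℝ) (u : ℝ) :
    HasDerivAt (fun u => Real.exp u * Q.eval (Real.exp u) * Real.exp (-Real.exp u ^ 2))
      (Real.exp u * (Q + Polynomial.X * Polynomial.derivative Q -
        2 * Polynomial.X ^ 2 * Q).eval (Real.exp u) * Real.exp (-Real.exp u ^ 2)) u := by
  have h1 := Real.hasDerivAt_exp u
  have h2 := (Q.hasDerivAt (Real.exp u)).comp u h1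
  have h3 := ((h1.pow 2).neg).exp
  refine ((h1.mul h2).mul h3).congr_deriv ?_
  simp
  ring

lemma iteratedDeriv_exp_mul_exp (n : ℕ) : ∃ Q : Polynomial ℝ,
    iteratedDeriv n (fun u => Real.exp u * Real.exp (-Real.exp u ^ 2)) =
      fun u => Real.exp u * Q.eval (Real.exp u) * Real.exp (-Real.exp u ^ 2) := by
  induction n with
  | zero => exact ⟨1, by simp⟩
  | succ n ih =>
    obtain ⟨Q, hQ⟩ := ih
    exact ⟨_, by rw [iteratedDeriv_succ, hQ]; exact funext fun u =>
      (hasDerivAt_exp_mul_eval_mul_exp Q u).deriv⟩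

lemma pow_mul_exp_neg_sq_le (j : ℕ) {w : ℝ} (hw : 0 ≤ w) :
    w ^ j * Real.exp (-w ^ 2) ≤ j.factorial * Real.exp 1 := by
  have h1 := Real.pow_div_factorial_le_exp w hw j
  rw [div_le_iff₀ (by positivity)] at h1
  calc w ^ j * Real.exp (-w ^ 2) ≤ (Real.exp w * j.factorial) * Real.exp (-w ^ 2) := by gcongr
    _ = j.factorial * Real.exp (w - w ^ 2) := by rw [sub_eq_add_neg, Real.exp_add]; ring
    _ ≤ j.factorial * Real.exp 1 := by
      gcongr
      nlinarith [sq_nonneg (w - 1)]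

/-- Bound |u|^m by m!(e^u + e^{-u}). The spare factor of e^u in the exponent `j + 1` absorbs e^{-u},
which controls u → -∞. -/
lemma exists_pow_mul_exp_bound (m j : ℕ) : ∃ C : ℝ, ∀ u : ℝ,
    |u| ^ m * (Real.exp u ^ (j + 1) * Real.exp (-Real.exp u ^ 2)) ≤ C := by
  refine ⟨m.factorial * ((j + 2).factorial * Real.exp 1 + j.factorial * Real.exp 1), fun u => ?_⟩
  have h1 := Real.pow_div_factorial_le_exp |u| (abs_nonneg u) m
  rw [div_le_iff₀ (by positivity)] at h1
  have h2 : Real.exp |u| ≤ Real.exp u + Real.exp (-u) := by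
    rcases abs_cases u with ⟨h, _⟩ | ⟨h, _⟩ <;> rw [h] <;> linarith [Real.exp_pos u, Real.exp_pos (-u)]
  have h3 : Real.exp (-u) * Real.exp u = 1 := by rw [← Real.exp_add]; simp
  calc |u| ^ m * (Real.exp u ^ (j + 1) * Real.exp (-Real.exp u ^ 2))
      ≤ ((Real.exp u + Real.exp (-u)) * m.factorial) *
        (Real.exp u ^ (j + 1) * Real.exp (-Real.exp u ^ 2)) := by
        gcongr
        exact h1.trans (by gcongr)
    _ = m.factorial * (Real.exp u ^ (j + 2) * Real.exp (-Real.exp u ^ 2) +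
        (Real.exp (-u) * Real.exp u) * (Real.exp u ^ j * Real.exp (-Real.exp u ^ 2))) := by ring
    _ ≤ _ := by
      rw [h3, one_mul]
      exact mul_le_mul_of_nonneg_left (add_le_add (pow_mul_exp_neg_sq_le _ (Real.exp_pos u).le)
        (pow_mul_exp_neg_sq_le _ (Real.exp_pos u).le)) (by positivity)

lemma exists_pow_mul_eval_exp_bound (m : ℕ) (Q : Polynomial ℝ) : ∃ C : ℝ, ∀ u : ℝ,
    |u| ^ m * |Real.exp u * Q.eval (Real.exp u) * Real.exp (-Real.exp u ^ 2)| ≤ C := by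
  induction Q using Polynomial.induction_on' with
  | add p q hp hq =>
    obtain ⟨C, hC⟩ := hp
    obtain ⟨D, hD⟩ := hq
    refine ⟨C + D, fun u => ?_⟩
    rw [Polynomial.eval_add, mul_add, add_mul]
    refine le_trans ?_ (add_le_add (hC u) (hD u))
    rw [← mul_add]
    gcongr
    exact abs_add_le _ _
  | monomial j a =>
    obtain ⟨C, hC⟩ := exists_pow_mul_exp_bound m j
    refine ⟨|a| * C, fun u => ?_⟩
    rw [Polynomial.eval_monomial]
    have : |Real.exp u * (a * Real.exp u ^ j) * Real.exp (-Real.exp u ^ 2)| =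
        |a| * (Real.exp u ^ (j + 1) * Real.exp (-Real.exp u ^ 2)) := by
      rw [abs_mul, abs_mul, abs_mul, abs_pow, Real.abs_exp, Real.abs_exp]; ring
    rw [this, mul_left_comm]
    gcongr
    exact hC u

/-- The kernel `e^u exp(-e^{2u})` as a Schwartz function. -/
noncomputable def expKernel : 𝓢(ℝ, ℝ) where
  toFun u := Real.exp u * Real.exp (-Real.exp u ^ 2)
  smooth' := by fun_prop
  decay' m n := by
    obtain ⟨Q, hQ⟩ := iteratedDeriv_exp_mul_exp n
    obtain ⟨C, hC⟩ := exists_pow_mul_eval_exp_bound m Q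
    refine ⟨C, fun u => ?_⟩
    rw [norm_iteratedFDeriv_eq_norm_iteratedDeriv, hQ]
    exact hC u

/-- A real Schwartz function regarded as a complex one. -/
noncomputable def complexify (k : 𝓢(ℝ, ℝ)) : 𝓢(ℝ, ℂ) :=
  SchwartzMap.postcompCLM (𝕜 := ℝ) Complex.ofRealCLM k

lemma complexify_apply (k : 𝓢(ℝ, ℝ)) (u : ℝ) : complexify k u = (k u : ℂ) := rfl

/-! ### Uniform bounds for the damped Riesz function -/

lemma norm_moebius_le_one (n : ℕ) : |(ArithmeticFunction.moebius n : ℝ)| ≤ 1 := by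
  exact_mod_cast ArithmeticFunction.abs_moebius_le_one

/-- The Riesz function with an additional damping factor `n^{-ε}`. -/
noncomputable def dampedRiesz (ε y : ℝ) : ℝ :=
  ∑' n : ℕ, (ArithmeticFunction.moebius n : ℝ) / (n : ℝ) ^ 2 * Real.exp (-y / (n : ℝ) ^ 2) *
    (n : ℝ) ^ (-ε)

/-- At v = (log y)/2 one has e^{v - log n} = √y/n, so the kernel becomes (√y/n) e^{-y/n²}. -/
lemma sqrt_mul_dampedRiesz (ε : ℝ) {y : ℝ} (hy : 0 < y) :
    ((Real.sqrt y * dampedRiesz ε y : ℝ) : ℂ) =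
      smoothedMoebius (complexify expKernel) ε (Real.log y / 2) := by
  rw [smoothedMoebius, dampedRiesz, ← tsum_mul_left, Complex.ofReal_tsum]
  refine tsum_congr fun n => ?_
  rcases eq_or_ne n 0 with rfl | hn
  · simp
  have hn0 : (0 : ℝ) < n := by positivity
  have e1 : Real.exp (Real.log y / 2 - Real.log n) = Real.sqrt y / n := by
    rw [Real.exp_sub, Real.exp_log hn0, Real.sqrt_eq_rpow, Real.rpow_def_of_pos hy]
    congr 2; ring
  have e2 : expKernel (Real.log y / 2 - Real.log n) =
      Real.sqrt y / n * Real.exp (-y / (n : ℝ) ^ 2) := by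
    change Real.exp _ * Real.exp (-Real.exp _ ^ 2) = _
    rw [e1, div_pow, Real.sq_sqrt hy.le, neg_div]
  have e3 : (n : ℝ) ^ (-(1 + ε)) = (n : ℝ)⁻¹ * (n : ℝ) ^ (-ε) := by
    rw [neg_add, Real.rpow_add hn0, Real.rpow_neg_one]
  rw [complexify_apply, e2, e3, ← Complex.ofReal_intCast, ← Complex.ofReal_mul,
    ← Complex.ofReal_mul]
  congr 1
  field_simp

lemma exists_dampedRiesz_bound : ∃ C : ℝ, 0 ≤ C ∧ ∀ ε : ℝ, 0 < ε → ε ≤ 1 → ∀ y : ℝ, 0 < y →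
    |dampedRiesz ε y| ≤ C / (Real.sqrt y * (1 + Real.log y ^ 2)) := by
  obtain ⟨C, hC, h⟩ := exists_smoothedMoebius_bound (complexify expKernel)
  -- The 4 comes from 1 + (log y / 2)² ≥ (1 + log² y)/4.
  refine ⟨4 * C, by positivity, fun ε h0 h1 y hy => ?_⟩
  have := h ε h0 h1 (Real.log y / 2)
  have hs : 0 < Real.sqrt y := Real.sqrt_pos.2 hy
  rw [← sqrt_mul_dampedRiesz ε hy, Complex.norm_real, Real.norm_eq_abs, abs_mul, abs_of_pos hs] at this
  rw [le_div_iff₀ (by positivity)] at this ⊢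
  have h2 : 0 ≤ √y * |dampedRiesz ε y| := by positivity
  nlinarith

lemma norm_dampedRiesz_term_le {ε y : ℝ} (hε : 0 ≤ ε) (hy : 0 ≤ y) (n : ℕ) :
    ‖(ArithmeticFunction.moebius n : ℝ) / (n : ℝ) ^ 2 * Real.exp (-y / (n : ℝ) ^ 2) *
      (n : ℝ) ^ (-ε)‖ ≤ 1 / (n : ℝ) ^ 2 := by
  rcases eq_or_ne n 0 with rfl | hn
  · simp
  have hn1 : (1 : ℝ) ≤ n := by exact_mod_cast Nat.one_le_iff_ne_zero.2 hn
  rw [Real.norm_eq_abs, abs_mul, abs_mul, abs_div, Real.abs_exp,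
    abs_of_pos (by positivity : (0:ℝ) < (n : ℝ) ^ 2), abs_of_nonneg (by positivity : 0 ≤ (n : ℝ) ^ (-ε))]
  have a := norm_moebius_le_one n
  have b : Real.exp (-y / (n : ℝ) ^ 2) ≤ 1 := Real.exp_le_one_iff.2 (by
    rw [neg_div]; exact neg_nonpos.2 (by positivity))
  have c : (n : ℝ) ^ (-ε) ≤ 1 := Real.rpow_le_one_of_one_le_of_nonpos hn1 (by simpa using hε)
  calc _ ≤ 1 / (n : ℝ) ^ 2 * 1 * 1 := by gcongr
    _ = _ := by ring

lemma tendsto_dampedRiesz {y : ℝ} (hy : 0 ≤ y) :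
    Tendsto (fun ε => dampedRiesz ε y) (𝓝[>] 0) (𝓝 (rieszFunction y)) := by
  refine tendsto_tsum_of_dominated_convergence (bound := fun n : ℕ => 1 / (n : ℝ) ^ 2)
    (Real.summable_one_div_nat_pow.2 one_lt_two) (fun n => ?_) ?_
  · rcases eq_or_ne n 0 with rfl | hn
    · simp
    have hn0 : (n : ℝ) ≠ 0 := by positivity
    have : ContinuousAt (fun ε : ℝ => (n : ℝ) ^ (-ε)) 0 :=
      (Real.continuousAt_const_rpow hn0).comp continuousAt_id.neg
    have h2 : Tendsto (fun ε : ℝ => (n : ℝ) ^ (-ε)) (𝓝[>] 0) (𝓝 1) := by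
      have h3 := this.tendsto.mono_left (nhdsWithin_le_nhds (s := Ioi 0))
      simpa using h3
    simpa using h2.const_mul ((ArithmeticFunction.moebius n : ℝ) / (n : ℝ) ^ 2 *
      Real.exp (-y / (n : ℝ) ^ 2))
  · filter_upwards [self_mem_nhdsWithin] with ε hε n
    exact norm_dampedRiesz_term_le (le_of_lt hε) hy n

/-! ### Convergence of ∑ μ(n)/n -/

lemma smoothedMoebius_eq_sum {k : ℝ → ℂ} {δ : ℝ} (hk : ∀ u, u ≤ -δ → k u = 0) (ε : ℝ) {v : ℝ}
    {M : ℕ} (hM : Real.exp (v + δ) ≤ M) : smoothedMoebius k ε v =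
      ∑ n ∈ Finset.Icc 1 M,
        (ArithmeticFunction.moebius n : ℂ) * ((n : ℝ) ^ (-(1 + ε)) : ℝ) * k (v - Real.log n) := by
  refine tsum_eq_sum fun n hn => ?_
  rcases Nat.eq_zero_or_pos n with rfl | h0
  · simp
  have hMn : M < n := by
    by_contra h
    exact hn (Finset.mem_Icc.2 ⟨h0, not_lt.1 h⟩)
  have : v + δ ≤ Real.log n := by
    rw [Real.le_log_iff_exp_le (by exact_mod_cast h0)]
    exact hM.trans (by exact_mod_cast hMn.le)
  rw [hk _ (by linarith), mul_zero]

/-- For a kernel vanishing far to the left the sum is finite, so ε → 0+ may be taken in it and the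
uniform bound survives. -/
lemma exists_smoothedMoebius_zero_bound (k : 𝓢(ℝ, ℂ)) {δ : ℝ} (hk : ∀ u, u ≤ -δ → k u = 0) :
    ∃ C : ℝ, 0 ≤ C ∧ ∀ v : ℝ, ‖smoothedMoebius k 0 v‖ ≤ C / (1 + v ^ 2) := by
  obtain ⟨C, hC, h⟩ := exists_smoothedMoebius_bound k
  refine ⟨C, hC, fun v => ?_⟩
  obtain ⟨M, hM⟩ := exists_nat_ge (Real.exp (v + δ))
  have hlim : Tendsto (fun ε => smoothedMoebius k ε v) (𝓝[>] 0) (𝓝 (smoothedMoebius k 0 v)) := by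
    simp_rw [smoothedMoebius_eq_sum hk _ hM]
    refine tendsto_finsetSum _ fun n hn => ?_
    have hn0 : (n : ℝ) ≠ 0 := by
      have := (Finset.mem_Icc.1 hn).1
      positivity
    have : ContinuousAt (fun ε : ℝ => (n : ℝ) ^ (-(1 + ε))) 0 :=
      (Real.continuousAt_const_rpow hn0).comp (f := fun ε : ℝ => -(1 + ε)) (by fun_prop)
    have h3 := this.tendsto.mono_left (nhdsWithin_le_nhds (s := Ioi 0))
    exact (((Complex.continuous_ofReal.tendsto _).comp h3).const_mul _).mul_const _
  refine le_of_tendsto hlim.norm ?_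
  filter_upwards [Ioo_mem_nhdsGT (zero_lt_one' ℝ)] with ε hε
  exact h ε hε.1 hε.2.le v

/-- A smooth step and its derivative, a bump supported in `[-δ, δ]`. -/
lemma exists_smooth_step {δ : ℝ} (hδ : 0 < δ) : ∃ (ψ : 𝓢(ℝ, ℝ)) (Φ : ℝ → ℝ),
    (∀ u, u ≤ -δ → ψ u = 0) ∧ (∀ u, HasDerivAt Φ (ψ u) u) ∧ (∀ u, u ≤ -δ → Φ u = 0) ∧
      (∀ u, δ ≤ u → Φ u = 1) ∧ ∀ u, |Φ u| ≤ 1 := by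
  let f : ContDiffBump (0 : ℝ) := ⟨δ / 2, δ, by positivity, by linarith⟩
  set ψ : ℝ → ℝ := f.normed volume with hψ
  have hcont : Continuous ψ := f.continuous_normed
  have hint : Integrable ψ := f.integrable_normed
  have hnn : ∀ u, 0 ≤ ψ u := fun u => f.nonneg_normed u
  have hsupp : ∀ u, δ ≤ |u| → ψ u = 0 := fun u hu => by
    have : u ∉ Function.support ψ := by
      rw [hψ, f.support_normed_eq]
      simpa [f] using hu
    simpa using this
  have htot : ∫ u, ψ u = 1 := f.integral_normed
  set Φ : ℝ → ℝ := fun v => ∫ u in (-δ)..v, ψ u with hΦ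
  have hl : ∀ v, v ≤ -δ → Φ v = 0 := fun v hv => by
    have : ∀ u ∈ uIcc (-δ) v, ψ u = 0 := fun u hu => by
      rw [uIcc_of_ge hv] at hu
      exact hsupp u (le_abs.2 (Or.inr (by linarith [hu.2])))
    simp only [hΦ]
    rw [intervalIntegral.integral_congr this]; simp
  have hr : ∀ v, δ ≤ v → Φ v = 1 := fun v hv => by
    simp only [hΦ]
    rw [← htot]
    refine intervalIntegral.integral_eq_integral_of_support_subset fun u hu => ?_
    have : |u| < δ := by
      by_contra h
      exact hu (hsupp u (not_lt.1 h))
    rw [abs_lt] at this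
    exact ⟨this.1, by linarith⟩
  have hmono : Monotone Φ := fun a b hab => by
    simp only [hΦ]
    have := intervalIntegral.integral_add_adjacent_intervals (hint.intervalIntegrable (a := -δ) (b := a))
      (hint.intervalIntegrable (a := a) (b := b))
    have := intervalIntegral.integral_nonneg (μ := volume) hab fun u _ => hnn u
    linarith
  refine ⟨(f.hasCompactSupport_normed (μ := volume)).toSchwartzMap f.contDiff_normed, Φ,
    fun u hu => hsupp u (le_abs.2 (Or.inr (by linarith))),
    fun u => hcont.integral_hasStrictDerivAt (-δ) u |>.hasDerivAt, hl, hr, fun u => abs_le.2 ⟨?_, ?_⟩⟩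
  · have h1 := hmono (min_le_left u (-δ))
    rw [hl _ (min_le_right _ _)] at h1
    linarith
  · have h1 := hmono (le_max_left u δ)
    rwa [hr _ (le_max_right _ _)] at h1

/-- The shift by `δ` puts every n ≤ N where `Φ` is 1, and terms beyond N e^{2δ} vanish. At most
N(e^{2δ} - 1) terms lie between, each at most 1/N. -/
lemma abs_sum_smooth_sub_le {Φ : ℝ → ℝ} {δ : ℝ} (hl : ∀ u, u ≤ -δ → Φ u = 0)
    (hr : ∀ u, δ ≤ u → Φ u = 1) (hb : ∀ u, |Φ u| ≤ 1) {N M : ℕ} (hN : 1 ≤ N) (hNM : N ≤ M) :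
    |∑ n ∈ Finset.Icc 1 M, (ArithmeticFunction.moebius n : ℝ) / n *
        Φ (Real.log N + δ - Real.log n) -
      ∑ n ∈ Finset.Icc 1 N, (ArithmeticFunction.moebius n : ℝ) / n| ≤ Real.exp (2 * δ) - 1 := by
  have hN0 : (0 : ℝ) < N := by exact_mod_cast hN
  -- For negative `δ` the hypotheses would force `Φ 0` to be both 0 and 1.
  by_cases hδ : 0 ≤ δ
  swap
  · have h1 := hl 0 (by linarith)
    have h2 := hr 0 (by linarith)
    linarith
  have hsplit : Finset.Icc 1 M = Finset.Icc 1 N ∪ Finset.Ioc N M := by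
    ext n; simp only [Finset.mem_union, Finset.mem_Icc, Finset.mem_Ioc]; omega
  have hdisj : Disjoint (Finset.Icc 1 N) (Finset.Ioc N M) :=
    Finset.disjoint_left.2 fun n h1 h2 => by
      simp only [Finset.mem_Icc, Finset.mem_Ioc] at h1 h2; omega
  rw [hsplit, Finset.sum_union hdisj]
  have e1 : ∑ n ∈ Finset.Icc 1 N, (ArithmeticFunction.moebius n : ℝ) / n *
        Φ (Real.log N + δ - Real.log n) =
      ∑ n ∈ Finset.Icc 1 N, (ArithmeticFunction.moebius n : ℝ) / n := by
    refine Finset.sum_congr rfl fun n hn => ?_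
    rw [Finset.mem_Icc] at hn
    have : Real.log n ≤ Real.log N :=
      Real.log_le_log (by exact_mod_cast hn.1) (by exact_mod_cast hn.2)
    rw [hr _ (by linarith), mul_one]
  rw [e1, add_sub_cancel_left]
  set q := ⌊(N : ℝ) * Real.exp (2 * δ)⌋₊ with hq
  have hterm : ∀ n ∈ Finset.Ioc N M, |(ArithmeticFunction.moebius n : ℝ) / n *
        Φ (Real.log N + δ - Real.log n)| ≤ if n ∈ Finset.Ioc N q then 1 / (N : ℝ) else 0 := by
    intro n hn
    rw [Finset.mem_Ioc] at hn
    have hn0 : (0 : ℝ) < n := hN0.trans (by exact_mod_cast hn.1)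
    split_ifs with h
    · rw [abs_mul, abs_div, abs_of_pos hn0]
      have a := norm_moebius_le_one n
      have b := hb (Real.log N + δ - Real.log n)
      have c : (N : ℝ) ≤ n := by exact_mod_cast hn.1.le
      calc _ ≤ 1 / (N : ℝ) * 1 := by gcongr
        _ = _ := mul_one _
    · have h1 : q < n := by
        by_contra h2
        exact h (Finset.mem_Ioc.2 ⟨hn.1, not_lt.1 h2⟩)
      have h2 : (N : ℝ) * Real.exp (2 * δ) < n := (Nat.floor_lt (by positivity)).1 h1
      have h3 := Real.log_lt_log (by positivity) h2
      rw [Real.log_mul hN0.ne' (Real.exp_ne_zero _), Real.log_exp] at h3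
      rw [hl _ (by linarith), mul_zero, abs_zero]
  have hNq : N ≤ q := Nat.le_floor (le_mul_of_one_le_right hN0.le
    (Real.one_le_exp (by linarith)))
  calc _ ≤ ∑ n ∈ Finset.Ioc N M, (if n ∈ Finset.Ioc N q then 1 / (N : ℝ) else 0) :=
        (Finset.abs_sum_le_sum_abs _ _).trans (Finset.sum_le_sum hterm)
    _ = ((Finset.Ioc N M).filter (· ∈ Finset.Ioc N q)).card * (1 / (N : ℝ)) := by
        rw [← Finset.sum_filter, Finset.sum_const, nsmul_eq_mul]
    _ ≤ ((q : ℝ) - N) * (1 / (N : ℝ)) := by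
        gcongr
        rw [← Nat.cast_sub hNq, ← Nat.card_Ioc N q]
        exact_mod_cast Finset.card_le_card fun n hn => (Finset.mem_filter.1 hn).2
    _ ≤ (N * Real.exp (2 * δ) - N) * (1 / (N : ℝ)) := by
        gcongr
        exact Nat.floor_le (by positivity)
    _ = Real.exp (2 * δ) - 1 := by field_simp

/-- The derivative in v of the smoothed partial sum is the smoothed Möbius sum with kernel `ψ`, and
its bound C/(1 + v²) integrates to an arctangent. -/
lemma norm_sum_smooth_sub_le {ψ : 𝓢(ℝ, ℝ)} {Φ : ℝ → ℝ} {δ C : ℝ} (hψ : ∀ u, u ≤ -δ → ψ u = 0)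
    (hΦ : ∀ u, HasDerivAt Φ (ψ u) u)
    (hC : ∀ v, ‖smoothedMoebius (complexify ψ) 0 v‖ ≤ C / (1 + v ^ 2)) {v w : ℝ} (hvw : v ≤ w)
    {M : ℕ} (hM : Real.exp (w + δ) ≤ M) :
    |∑ n ∈ Finset.Icc 1 M, (ArithmeticFunction.moebius n : ℝ) / n * Φ (w - Real.log n) -
      ∑ n ∈ Finset.Icc 1 M, (ArithmeticFunction.moebius n : ℝ) / n * Φ (v - Real.log n)| ≤
      C * (Real.arctan w - Real.arctan v) := by
  have hd : ∀ u, HasDerivAt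
      (fun u => ∑ n ∈ Finset.Icc 1 M, (ArithmeticFunction.moebius n : ℝ) / n * Φ (u - Real.log n))
      (∑ n ∈ Finset.Icc 1 M, (ArithmeticFunction.moebius n : ℝ) / n * ψ (u - Real.log n)) u :=
    fun u => HasDerivAt.fun_sum fun n _ => ((hΦ _).comp_sub_const u (Real.log n)).const_mul _
  have hcont : Continuous fun u => ∑ n ∈ Finset.Icc 1 M,
      (ArithmeticFunction.moebius n : ℝ) / n * ψ (u - Real.log n) :=
    continuous_finsetSum _ fun n _ => continuous_const.mul
      (ψ.continuous.comp (continuous_id.sub continuous_const))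
  rw [← intervalIntegral.integral_eq_sub_of_hasDerivAt (fun u _ => hd u)
    (hcont.intervalIntegrable _ _), ← integral_one_div_one_add_sq,
    ← intervalIntegral.integral_const_mul, ← Real.norm_eq_abs]
  refine intervalIntegral.norm_integral_le_of_norm_le hvw (ae_of_all _ fun u hu => ?_) ?_
  · have h1 := hC u
    rw [smoothedMoebius_eq_sum (δ := δ) (M := M) (fun u hu => by
      rw [complexify_apply, hψ u hu, Complex.ofReal_zero]) 0
      ((Real.exp_le_exp.2 (by linarith [hu.2])).trans hM)] at h1
    rw [mul_one_div]
    convert h1 using 1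
    rw [← Complex.norm_real]
    congr 1
    push_cast
    refine Finset.sum_congr rfl fun n _ => ?_
    rw [complexify_apply]
    simp [Real.rpow_neg_one, div_eq_mul_inv]
  · refine Continuous.intervalIntegrable ?_ _ _
    exact continuous_const.mul (continuous_const.div (by fun_prop) fun x => by positivity)

/-- Convergence of `∑ μ(n)/n`, equivalent to the prime number theorem. -/
theorem exists_tendsto_sum_moebius_div : ∃ l : ℝ, Tendsto
    (fun N : ℕ => ∑ n ∈ Finset.Icc 1 N, (ArithmeticFunction.moebius n : ℝ) / n) atTop (𝓝 l) := by
  refine cauchySeq_tendsto_of_complete (Metric.cauchySeq_iff'.2 fun η hη => ?_)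
  -- Chosen so that e^{2δ} - 1 = η/4. Two smoothing errors and the arctangent tail then total less
  -- than η.
  set δ := Real.log (1 + η / 4) / 2 with hδ
  have hδ0 : 0 < δ := div_pos (Real.log_pos (by linarith)) two_pos
  have hexp : Real.exp (2 * δ) - 1 = η / 4 := by
    rw [hδ, mul_div_cancel₀ _ two_ne_zero, Real.exp_log (by linarith)]; ring
  obtain ⟨ψ, Φ, hψ, hd, hl, hr, hb⟩ := exists_smooth_step hδ0
  obtain ⟨C, hC, hC2⟩ := exists_smoothedMoebius_zero_bound (complexify ψ) (δ := δ) fun u hu => by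
    rw [complexify_apply, hψ u hu, Complex.ofReal_zero]
  have hv : Tendsto (fun N : ℕ => C * (Real.pi / 2 - Real.arctan (Real.log N + δ))) atTop (𝓝 0) := by
    have h1 : Tendsto (fun N : ℕ => Real.log N + δ) atTop atTop :=
      tendsto_atTop_add_const_right _ _ (Real.tendsto_log_atTop.comp tendsto_natCast_atTop_atTop)
    have h2 := (Real.tendsto_arctan_atTop.mono_right nhdsWithin_le_nhds).comp h1
    simpa using (h2.const_sub (Real.pi / 2)).const_mul C
  obtain ⟨N, hN, hN1⟩ := ((hv.eventually_lt_const (by linarith : 0 < η / 4)).and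
    (eventually_ge_atTop 1)).exists
  refine ⟨N, fun N' hN' => ?_⟩
  obtain ⟨M, hM⟩ := exists_nat_ge (Real.exp (Real.log N' + δ + δ))
  have hN'0 : (0 : ℝ) < N' := by exact_mod_cast hN1.trans hN'
  have hM' : N' ≤ M := by
    have : (N' : ℝ) ≤ M := by
      refine le_trans ?_ hM
      conv_lhs => rw [← Real.exp_log hN'0]
      exact Real.exp_le_exp.2 (by linarith)
    exact_mod_cast this
  have hle : Real.log N + δ ≤ Real.log N' + δ := by
    gcongr
  have a := abs_sum_smooth_sub_le hl hr hb hN1 (hN'.trans hM')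
  have b := abs_sum_smooth_sub_le hl hr hb (hN1.trans hN') hM'
  have c := norm_sum_smooth_sub_le hψ hd hC2 hle hM
  have d : C * (Real.arctan (Real.log N' + δ) - Real.arctan (Real.log N + δ)) < η / 4 :=
    lt_of_le_of_lt (by gcongr; exact (Real.arctan_lt_pi_div_two _).le) hN
  rw [hexp] at a b
  rw [Real.dist_eq]
  rw [abs_le] at a b c
  rw [abs_lt]
  constructor <;> linarith [a.1, a.2, b.1, b.2, c.1, c.2]

/-! ### The error function weight and its Laplace transform -/

lemma integral_Ioi_zero_of_hasDerivAt {F f : ℝ → ℝ} {a b : ℝ}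
    (h : ∀ y, 0 < y → HasDerivAt F (f y) y) (hn : ∀ y, 0 < y → 0 ≤ f y)
    (h0 : Tendsto F (𝓝[>] 0) (𝓝 a)) (hi : Tendsto F atTop (𝓝 b)) :
    IntegrableOn f (Ioi 0) ∧ ∫ y in Ioi (0 : ℝ), f y = b - a := by
  -- The value of `F` at `0` is arbitrary; replacing it by the limit gives continuity at the
  -- endpoint.
  set G := Function.update F 0 a with hG
  have hGF : ∀ y, 0 < y → G =ᶠ[𝓝 y] F := fun y hy => by
    filter_upwards [eventually_ne_nhds hy.ne'] with z hz
    exact Function.update_of_ne hz _ _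
  have hcont : ContinuousWithinAt G (Ici 0) 0 := by
    rw [hG, continuousWithinAt_update_same, Ici_sdiff_left]
    exact h0
  have hd : ∀ y ∈ Ioi (0 : ℝ), HasDerivAt G (f y) y := fun y hy =>
    (h y hy).congr_of_eventuallyEq (hGF y hy)
  have hi' : Tendsto G atTop (𝓝 b) := hi.congr' (by
    filter_upwards [eventually_gt_atTop 0] with y hy
    exact (Function.update_of_ne hy.ne' _ _).symm)
  refine ⟨integrableOn_Ioi_deriv_of_nonneg hcont hd hn hi', ?_⟩
  rw [integral_Ioi_of_hasDerivAt_of_nonneg hcont hd hn hi', hG, Function.update_self]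

lemma hasDerivAt_erf (x : ℝ) : HasDerivAt erf (2 / √Real.pi * Real.exp (-x ^ 2)) x := by
  have h : Continuous fun t : ℝ => Real.exp (-t ^ 2) := by fun_prop
  exact (h.integral_hasStrictDerivAt 0 x).hasDerivAt.const_mul _

lemma erf_neg (x : ℝ) : erf (-x) = -erf x := by
  have := intervalIntegral.integral_comp_neg (a := 0) (b := x) fun t : ℝ => Real.exp (-t ^ 2)
  simp only [neg_sq, neg_zero] at this
  rw [erf, erf, this, intervalIntegral.integral_symm, mul_neg]

lemma tendsto_erf_atTop : Tendsto erf atTop (𝓝 1) := by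
  have hi : Integrable fun t : ℝ => Real.exp (-t ^ 2) := by
    simpa using integrable_exp_neg_mul_sq one_pos
  have h := intervalIntegral_tendsto_integral_Ioi 0 hi.integrableOn tendsto_id
  have e : ∫ t in Ioi (0 : ℝ), Real.exp (-t ^ 2) = √Real.pi / 2 := by
    simpa using integral_gaussian_Ioi 1
  rw [e] at h
  have h2 := h.const_mul (2 / √Real.pi)
  have : 2 / √Real.pi * (√Real.pi / 2) = 1 := by
    have := Real.sqrt_pos.2 Real.pi_pos
    field_simp
  rw [this] at h2
  exact h2

lemma tendsto_erf_atBot : Tendsto erf atBot (𝓝 (-1)) := by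
  have := (tendsto_erf_atTop.comp tendsto_neg_atBot_atTop).neg
  refine this.congr fun x => ?_
  simp [erf_neg]

/-- The Laplace transform of the heat kernel. -/
lemma laplace_heatKernel {a u : ℝ} (ha : 0 < a) (hu : 0 < u) :
    IntegrableOn (fun y => Real.exp (-(a ^ 2 * y)) * (Real.exp (-(u ^ 2 / (4 * y))) / √(Real.pi * y)))
      (Ioi 0) ∧
    ∫ y in Ioi (0 : ℝ), Real.exp (-(a ^ 2 * y)) * (Real.exp (-(u ^ 2 / (4 * y))) / √(Real.pi * y)) =
      Real.exp (-(u * a)) / a := by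
  -- An explicit antiderivative. As y → 0+ the second erf tends to -1 and as y → ∞ to 1, while the
  -- first tends to 1 both times, so the difference of limits is e^{-ua}/a.
  set F : ℝ → ℝ := fun y => (Real.exp (u * a) * erf (a * √y + u / 2 / √y) +
    Real.exp (-(u * a)) * erf (a * √y - u / 2 / √y)) / (2 * a) with hF
  have hs0 : Tendsto (fun y : ℝ => √y) (𝓝[>] 0) (𝓝[>] 0) := by
    refine tendsto_nhdsWithin_iff.2 ⟨?_, ?_⟩
    · have := Real.continuous_sqrt.tendsto 0
      rw [Real.sqrt_zero] at this
      exact this.mono_left nhdsWithin_le_nhds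
    · filter_upwards [self_mem_nhdsWithin] with y hy using Real.sqrt_pos.2 hy
  have hinv0 : Tendsto (fun y : ℝ => u / 2 / √y) (𝓝[>] 0) atTop := by
    simp_rw [div_eq_mul_inv (u / 2)]
    exact (tendsto_inv_nhdsGT_zero.comp hs0).const_mul_atTop (by positivity)
  have hmul0 : Tendsto (fun y : ℝ => a * √y) (𝓝[>] 0) (𝓝 0) := by
    simpa using (hs0.mono_right nhdsWithin_le_nhds).const_mul a
  have hmuli : Tendsto (fun y : ℝ => a * √y) atTop atTop :=
    Real.tendsto_sqrt_atTop.const_mul_atTop ha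
  have hinvi : Tendsto (fun y : ℝ => u / 2 / √y) atTop (𝓝 0) :=
    Real.tendsto_sqrt_atTop.const_div_atTop _
  have key := integral_Ioi_zero_of_hasDerivAt (F := F)
    (f := fun y => Real.exp (-(a ^ 2 * y)) * (Real.exp (-(u ^ 2 / (4 * y))) / √(Real.pi * y)))
    (a := (Real.exp (u * a) * 1 + Real.exp (-(u * a)) * (-1)) / (2 * a))
    (b := (Real.exp (u * a) * 1 + Real.exp (-(u * a)) * 1) / (2 * a)) ?_ ?_ ?_ ?_
  · refine ⟨key.1, key.2.trans ?_⟩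
    field_simp
    ring
  · intro y hy
    set s := √y with hs
    have hs0 : 0 < s := Real.sqrt_pos.2 hy
    have hsq : y = s ^ 2 := (Real.sq_sqrt hy.le).symm
    have d := Real.hasDerivAt_sqrt hy.ne'
    have d1 := d.const_mul a
    have d2 := (hasDerivAt_const y (u / 2)).div d hs0.ne'
    have k := (((hasDerivAt_erf _).comp y (d1.add d2)).const_mul (Real.exp (u * a))).add
      (((hasDerivAt_erf _).comp y (d1.sub d2)).const_mul (Real.exp (-(u * a))))
    have k2 : HasDerivAt F _ y := k.div_const (2 * a)
    refine k2.congr_deriv ?_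
    simp only [Pi.add_apply, Pi.sub_apply, Pi.div_apply, ← hs]
    have x1 : Real.exp (-(a * s + u / 2 / s) ^ 2) =
        Real.exp (-(a ^ 2 * y)) * Real.exp (-(u ^ 2 / (4 * y))) * Real.exp (-(u * a)) := by
      rw [← Real.exp_add, ← Real.exp_add, hsq]; congr 1; field_simp; ring
    have x2 : Real.exp (-(a * s - u / 2 / s) ^ 2) =
        Real.exp (-(a ^ 2 * y)) * Real.exp (-(u ^ 2 / (4 * y))) * Real.exp (u * a) := by
      rw [← Real.exp_add, ← Real.exp_add, hsq]; congr 1; field_simp; ring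
    have x3 : Real.exp (u * a) * Real.exp (-(u * a)) = 1 := by rw [← Real.exp_add]; simp
    rw [x1, x2, Real.sqrt_mul Real.pi_pos.le, ← hs, mul_div_assoc' (Real.exp (-(a ^ 2 * y)))]
    have hp := Real.sqrt_pos.2 Real.pi_pos
    generalize Real.exp (-(a ^ 2 * y)) * Real.exp (-(u ^ 2 / (4 * y))) = Z at *
    rw [show ∀ A B : ℝ, A * (2 / √Real.pi * (Z * Real.exp (-(u * a))) * B) =
      (A * Real.exp (-(u * a))) * (2 / √Real.pi * Z * B) from fun A B => by ring,
      show ∀ A B : ℝ, A * (2 / √Real.pi * (Z * Real.exp (u * a)) * B) =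
      (Real.exp (u * a) * A) * (2 / √Real.pi * Z * B) from fun A B => by ring, x3]
    field_simp
    ring
  · intro y hy
    positivity
  · have l1 : Tendsto (fun y => a * √y + u / 2 / √y) (𝓝[>] 0) atTop := hmul0.add_atTop hinv0
    have l2 : Tendsto (fun y => a * √y - u / 2 / √y) (𝓝[>] 0) atBot := by
      simp_rw [sub_eq_add_neg]
      exact hmul0.add_atBot (tendsto_neg_atTop_atBot.comp hinv0)
    exact (((tendsto_erf_atTop.comp l1).const_mul _).add
      ((tendsto_erf_atBot.comp l2).const_mul _)).div_const _
  · have l1 : Tendsto (fun y => a * √y + u / 2 / √y) atTop atTop := hmuli.atTop_add hinvi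
    have l2 : Tendsto (fun y => a * √y - u / 2 / √y) atTop atTop := by
      simp_rw [sub_eq_add_neg]
      exact hmuli.atTop_add hinvi.neg
    exact (((tendsto_erf_atTop.comp l1).const_mul _).add
      ((tendsto_erf_atTop.comp l2).const_mul _)).div_const _

/-- The weight against which the Riesz function is integrated. -/
noncomputable def erfWeight (r L y : ℝ) : ℝ :=
  Real.exp (y * r ^ 2) * (erf (√y * (r + L / (2 * y))) - erf (r * √y))

/-- Differentiating e^{yr²} erf(√y(r + u/(2y))) in u cancels e^{yr²} by completing the square. The
sign, size and Laplace transform of the weight are read off from this form. -/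
lemma erfWeight_eq_integral (r L : ℝ) {y : ℝ} (hy : 0 < y) :
    erfWeight r L y =
      ∫ u in (0 : ℝ)..L, Real.exp (-(r * u)) * (Real.exp (-(u ^ 2 / (4 * y))) / √(Real.pi * y)) := by
  have hd : ∀ u : ℝ, HasDerivAt (fun u => Real.exp (y * r ^ 2) * erf (√y * (r + u / (2 * y))))
      (Real.exp (-(r * u)) * (Real.exp (-(u ^ 2 / (4 * y))) / √(Real.pi * y))) u := by
    intro u
    have d : HasDerivAt (fun u => √y * (r + u / (2 * y))) (√y * (1 / (2 * y))) u :=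
      (((hasDerivAt_id u).div_const (2 * y)).const_add r).const_mul (√y)
    refine (((hasDerivAt_erf _).comp u d).const_mul (Real.exp (y * r ^ 2))).congr_deriv ?_
    set s := √y with hs
    have hs0 : 0 < s := Real.sqrt_pos.2 hy
    have hsq : y = s ^ 2 := (Real.sq_sqrt hy.le).symm
    have x1 : Real.exp (-(s * (r + u / (2 * y))) ^ 2) =
        (Real.exp (y * r ^ 2))⁻¹ * Real.exp (-(r * u)) * Real.exp (-(u ^ 2 / (4 * y))) := by
      rw [← Real.exp_neg, ← Real.exp_add, ← Real.exp_add, hsq]; congr 1; field_simp; ring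
    rw [x1, Real.sqrt_mul Real.pi_pos.le, ← hs]
    have hp := Real.sqrt_pos.2 Real.pi_pos
    have h3 : s * (1 / (2 * y)) = 1 / (2 * s) := by rw [hsq]; field_simp
    rw [h3]
    field_simp
  have hc : Continuous fun u : ℝ =>
      Real.exp (-(r * u)) * (Real.exp (-(u ^ 2 / (4 * y))) / √(Real.pi * y)) := by fun_prop
  rw [intervalIntegral.integral_eq_sub_of_hasDerivAt (fun u _ => hd u) (hc.intervalIntegrable _ _),
    erfWeight, mul_sub]
  simp [mul_comm]

lemma erfWeight_nonneg (r : ℝ) {L y : ℝ} (hL : 0 ≤ L) (hy : 0 < y) : 0 ≤ erfWeight r L y := by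
  rw [erfWeight_eq_integral r L hy]
  exact intervalIntegral.integral_nonneg hL fun u _ => by positivity

lemma erfWeight_le {r L y : ℝ} (hr : 0 ≤ r) (hL : 0 ≤ L) (hy : 0 < y) :
    erfWeight r L y ≤ L / √y := by
  rw [erfWeight_eq_integral r L hy]
  have hs0 : 0 < √y := Real.sqrt_pos.2 hy
  have hc : Continuous fun u : ℝ =>
      Real.exp (-(r * u)) * (Real.exp (-(u ^ 2 / (4 * y))) / √(Real.pi * y)) := by fun_prop
  have h : ∀ u ∈ Icc 0 L,
      Real.exp (-(r * u)) * (Real.exp (-(u ^ 2 / (4 * y))) / √(Real.pi * y)) ≤ 1 / √y := by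
    intro u hu
    have a : Real.exp (-(r * u)) ≤ 1 := Real.exp_le_one_iff.2 (neg_nonpos.2 (mul_nonneg hr hu.1))
    have b : Real.exp (-(u ^ 2 / (4 * y))) ≤ 1 := Real.exp_le_one_iff.2 (neg_nonpos.2 (by positivity))
    have c : √y ≤ √(Real.pi * y) := Real.sqrt_le_sqrt (by nlinarith [Real.pi_gt_three])
    calc _ ≤ 1 * (1 / √y) := by gcongr
      _ = _ := one_mul _
  have := intervalIntegral.integral_mono_on hL (hc.intervalIntegrable _ _)
    (intervalIntegrable_const (μ := volume)) h
  rw [intervalIntegral.integral_const, sub_zero, smul_eq_mul, mul_one_div] at this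
  exact this

lemma measurable_erfWeight (r L : ℝ) : Measurable (erfWeight r L) := by
  have : Measurable erf :=
    (continuous_iff_continuousAt.2 fun x => (hasDerivAt_erf x).continuousAt).measurable
  unfold erfWeight
  fun_prop

/-- By Tonelli the y-integral is done first, giving e^{-ua}/a from the heat kernel; what is left is
∫_0^L e^{-(r+a)u} du / a. -/
lemma laplace_erfWeight {r L a : ℝ} (hr : 0 < r) (hL : 0 ≤ L) (ha : 0 < a) :
    IntegrableOn (fun y => Real.exp (-(a ^ 2 * y)) * erfWeight r L y) (Ioi 0) ∧
    ∫ y in Ioi (0 : ℝ), Real.exp (-(a ^ 2 * y)) * erfWeight r L y =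
      (1 - Real.exp (-((r + a) * L))) / (a * (r + a)) := by
  set K : ℝ → ℝ → ℝ := fun y u => Real.exp (-(r * u)) *
    (Real.exp (-(a ^ 2 * y)) * (Real.exp (-(u ^ 2 / (4 * y))) / √(Real.pi * y))) with hK
  have hKnn : ∀ y u, 0 ≤ K y u := fun y u => by positivity
  have hmeas : Measurable (Function.uncurry K) := by
    simp only [hK, Function.uncurry_def]; fun_prop
  have hexp : Continuous fun u : ℝ => Real.exp (-(r * u)) * (Real.exp (-(u * a)) / a) := by fun_prop
  have hinner : ∀ u, 0 < u → ∫ y in Ioi (0 : ℝ), K y u =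
      Real.exp (-(r * u)) * (Real.exp (-(u * a)) / a) := fun u hu => by
    rw [← (laplace_heatKernel ha hu).2, ← integral_const_mul]
  have hprod : Integrable (Function.uncurry K)
      ((volume.restrict (Ioi (0 : ℝ))).prod (volume.restrict (Ioc 0 L))) := by
    rw [integrable_prod_iff' hmeas.aestronglyMeasurable]
    refine ⟨ae_restrict_of_forall_mem measurableSet_Ioc fun u hu =>
      (laplace_heatKernel ha hu.1).1.const_mul (Real.exp (-(r * u))), ?_⟩
    refine ((hexp.integrableOn_Icc (a := 0) (b := L)).mono_set Ioc_subset_Icc_self).congr ?_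
    refine ae_restrict_of_forall_mem measurableSet_Ioc fun u hu => ?_
    simp only [Function.uncurry_apply_pair, Real.norm_of_nonneg (hKnn _ _)]
    exact (hinner u hu.1).symm
  have hw : ∀ y ∈ Ioi (0 : ℝ), ∫ u in Ioc 0 L, K y u = Real.exp (-(a ^ 2 * y)) * erfWeight r L y := by
    intro y hy
    rw [erfWeight_eq_integral r L hy, intervalIntegral.integral_of_le hL, ← integral_const_mul]
    simp only [hK]
    congr 1; ext u; ring
  constructor
  · refine hprod.integral_prod_left.congr ?_
    exact ae_restrict_of_forall_mem measurableSet_Ioi hw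
  · rw [← setIntegral_congr_fun measurableSet_Ioi hw, integral_integral_swap hprod,
      setIntegral_congr_fun measurableSet_Ioc fun u hu => hinner u hu.1,
      ← intervalIntegral.integral_of_le hL]
    have hd : ∀ u : ℝ, HasDerivAt (fun u => -Real.exp (-((r + a) * u)) / (a * (r + a)))
        (Real.exp (-(r * u)) * (Real.exp (-(u * a)) / a)) u := by
      intro u
      have d := (((hasDerivAt_id u).const_mul (r + a)).neg.exp.neg).div_const (a * (r + a))
      refine HasDerivAt.congr_deriv d ?_
      have : Real.exp (-(r * u)) * (Real.exp (-(u * a)) / a) = Real.exp (-((r + a) * u)) / a := by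
        rw [mul_div_assoc', ← Real.exp_add]; congr 2; ring
      rw [this]
      simp
      field_simp
      ring
    rw [intervalIntegral.integral_eq_sub_of_hasDerivAt (fun u _ => hd u) (hexp.intervalIntegrable _ _)]
    simp
    ring

/-- The antiderivative arctan(log y) has finite limits at both ends. -/
lemma integrableOn_one_div_mul_one_add_log_sq :
    IntegrableOn (fun y : ℝ => 1 / (y * (1 + Real.log y ^ 2))) (Ioi 0) := by
  refine (integral_Ioi_zero_of_hasDerivAt (F := fun y => Real.arctan (Real.log y))
    (a := -(Real.pi / 2)) (b := Real.pi / 2) (fun y hy => ?_) (fun y hy => by positivity) ?_ ?_).1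
  · refine ((Real.hasDerivAt_log hy.ne').arctan).congr_deriv ?_
    field_simp
  · exact (Real.tendsto_arctan_atBot.mono_right nhdsWithin_le_nhds).comp Real.tendsto_log_nhdsGT_zero
  · exact (Real.tendsto_arctan_atTop.mono_right nhdsWithin_le_nhds).comp Real.tendsto_log_atTop

/-! ### Abel summation -/

lemma sum_range_mul_eq_summation_by_parts (a g : ℕ → ℝ) (l : ℝ) (hg : g 0 = 1) (N : ℕ) :
    ∑ n ∈ Finset.range (N + 1), a n * g n =
      l + (∑ k ∈ Finset.range (N + 1), a k - l) * g N +
      ∑ n ∈ Finset.range N, (∑ k ∈ Finset.range (n + 1), a k - l) * (g n - g (n + 1)) := by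
  induction N with
  | zero => simp [hg]
  | succ N ih =>
    rw [Finset.sum_range_succ (fun n => a n * g n), ih, Finset.sum_range_succ
      (fun n => (∑ k ∈ Finset.range (n + 1), a k - l) * (g n - g (n + 1))) N,
      Finset.sum_range_succ a (N + 1)]
    ring

/-- After summation by parts the weights `g n - g (n + 1)` are nonnegative: those before `K` total
`1 - g K` and meet deviations at most `B`; those after total at most 1 and meet `η`. The boundary
term accounts for the second `η`. -/
lemma abs_sum_range_mul_sub_le {a g : ℕ → ℝ} {l B η : ℝ} (hg0 : g 0 = 1) (hg : Antitone g)
    (hgnn : ∀ n, 0 ≤ g n) (hB : ∀ n, |∑ k ∈ Finset.range (n + 1), a k - l| ≤ B) {K : ℕ}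
    (hK : ∀ n, K ≤ n → |∑ k ∈ Finset.range (n + 1), a k - l| ≤ η) {N : ℕ} (hN : K ≤ N) :
    |∑ n ∈ Finset.range (N + 1), a n * g n - l| ≤ B * (1 - g K) + 2 * η := by
  have hη : 0 ≤ η := (abs_nonneg _).trans (hK K le_rfl)
  have h1 : ∀ n, g n ≤ 1 := fun n => hg0 ▸ hg n.zero_le
  have hw : ∀ n, 0 ≤ g n - g (n + 1) := fun n => sub_nonneg.2 (hg n.le_succ)
  have key : ∑ n ∈ Finset.range N, |∑ k ∈ Finset.range (n + 1), a k - l| * (g n - g (n + 1)) ≤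
      B * (1 - g K) + η * (g K - g N) := by
    induction N, hN using Nat.le_induction with
    | base =>
      rw [sub_self, mul_zero, add_zero, ← hg0, ← Finset.sum_range_sub' g K, Finset.mul_sum]
      exact Finset.sum_le_sum fun n _ => mul_le_mul_of_nonneg_right (hB n) (hw n)
    | succ N hN ih =>
      rw [Finset.sum_range_succ]
      have := mul_le_mul_of_nonneg_right (hK N hN) (hw N)
      linarith
  rw [sum_range_mul_eq_summation_by_parts a g l hg0]
  have h2 : |(∑ k ∈ Finset.range (N + 1), a k - l) * g N| ≤ η := by
    rw [abs_mul, abs_of_nonneg (hgnn N)]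
    exact (mul_le_mul (hK N hN) (h1 N) (hgnn N) hη).trans_eq (mul_one η)
  have h3 : |∑ n ∈ Finset.range N, (∑ k ∈ Finset.range (n + 1), a k - l) * (g n - g (n + 1))| ≤
      B * (1 - g K) + η * (g K - g N) := by
    refine (Finset.abs_sum_le_sum_abs _ _).trans (le_trans (Finset.sum_le_sum fun n _ => ?_) key)
    rw [abs_mul, abs_of_nonneg (hw n)]
  have h4 : η * (g K - g N) ≤ η := by
    nlinarith [h1 K, hgnn N]
  rw [show ∀ x y : ℝ, l + x + y - l = x + y from fun x y => by ring]
  refine (abs_add_le _ _).trans ?_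
  linarith

/-- Abel summation of a convergent series by Dirichlet factors. -/
theorem tendsto_tsum_mul_rpow_neg {a : ℕ → ℝ} {l : ℝ} (ha0 : a 0 = 0)
    (hl : Tendsto (fun N : ℕ => ∑ n ∈ Finset.Icc 1 N, a n) atTop (𝓝 l))
    (hs : ∀ ε : ℝ, 0 < ε → Summable fun n : ℕ => a n * (n : ℝ) ^ (-ε)) :
    Tendsto (fun ε : ℝ => ∑' n : ℕ, a n * (n : ℝ) ^ (-ε)) (𝓝[>] 0) (𝓝 l) := by
  have hIcc : ∀ N : ℕ, ∑ n ∈ Finset.Icc 1 (N + 1), a n = ∑ n ∈ Finset.range (N + 1), a (n + 1) := by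
    intro N
    rw [Finset.range_eq_Ico, Finset.sum_Ico_add' a 0 (N + 1) 1]
    rfl
  have hl' : Tendsto (fun N : ℕ => ∑ n ∈ Finset.range (N + 1), a (n + 1) - l) atTop (𝓝 0) := by
    have := (hl.comp (tendsto_add_atTop_nat 1)).sub_const l
    simpa [Function.comp_def, hIcc] using this
  obtain ⟨B, hB⟩ : ∃ B, ∀ n, |∑ k ∈ Finset.range (n + 1), a (k + 1) - l| ≤ B := by
    obtain ⟨B, hB⟩ := hl'.abs.bddAbove_range
    exact ⟨B, fun n => hB ⟨n, rfl⟩⟩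
  rw [Metric.tendsto_nhds]
  intro η hη
  obtain ⟨K, hK⟩ := Metric.tendsto_atTop.1 hl' (η / 4) (by positivity)
  have hgK : Tendsto (fun ε : ℝ => B * (1 - ((K + 1 : ℕ) : ℝ) ^ (-ε))) (𝓝[>] 0) (𝓝 0) := by
    have hK0 : ((K + 1 : ℕ) : ℝ) ≠ 0 := by positivity
    have : ContinuousAt (fun ε : ℝ => ((K + 1 : ℕ) : ℝ) ^ (-ε)) 0 :=
      (Real.continuousAt_const_rpow hK0).comp continuousAt_id.neg
    have h3 := this.tendsto.mono_left (nhdsWithin_le_nhds (s := Ioi 0))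
    simpa using (h3.const_sub 1).const_mul B
  filter_upwards [self_mem_nhdsWithin, hgK.eventually_lt_const (by positivity : 0 < η / 4)]
    with ε hε hsmall
  have hε0 : 0 < ε := hε
  have hsum : HasSum (fun n : ℕ => a (n + 1) * ((n + 1 : ℕ) : ℝ) ^ (-ε))
      (∑' n : ℕ, a n * (n : ℝ) ^ (-ε)) := by
    have := (hasSum_nat_add_iff' 1).2 (hs ε hε0).hasSum
    simpa [ha0] using this
  have hlim := ((hsum.tendsto_sum_nat.comp (tendsto_add_atTop_nat 1)).sub_const l).abs
  have hle : |∑' n : ℕ, a n * (n : ℝ) ^ (-ε) - l| ≤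
      B * (1 - ((K + 1 : ℕ) : ℝ) ^ (-ε)) + 2 * (η / 4) := by
    refine le_of_tendsto hlim ?_
    filter_upwards [eventually_ge_atTop K] with N hN
    -- The index is shifted by one so that `g 0` is 1^{-ε} = 1 and `g` is antitone.
    refine abs_sum_range_mul_sub_le (a := fun n => a (n + 1))
      (g := fun n : ℕ => ((n + 1 : ℕ) : ℝ) ^ (-ε)) (by simp) (fun m n hmn => ?_)
      (fun n => by positivity) hB (fun n hn => ?_) hN
    · exact Real.rpow_le_rpow_of_nonpos (by positivity) (by exact_mod_cast Nat.succ_le_succ hmn)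
        (by linarith)
    · have := hK n hn
      rw [Real.dist_eq, sub_zero] at this
      exact this.le
  rw [Real.dist_eq]
  linarith

/-! ### Termwise integration and removal of the damping -/

/-- The integral `∫ n^{-2} e^{-y/n²}` of the weight, in closed form. -/
noncomputable def weightCoeff (r L : ℝ) (n : ℕ) : ℝ :=
  (1 - Real.exp (-((r + 1 / (n : ℝ)) * L))) / (r * n + 1)

lemma weightCoeff_nonneg {r L : ℝ} (hr : 0 < r) (hL : 0 ≤ L) (n : ℕ) : 0 ≤ weightCoeff r L n := by
  have : Real.exp (-((r + 1 / (n : ℝ)) * L)) ≤ 1 :=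
    Real.exp_le_one_iff.2 (neg_nonpos.2 (by positivity))
  exact div_nonneg (by linarith) (by positivity)

lemma weightCoeff_le {r L : ℝ} (hr : 1 ≤ r) {n : ℕ} (hn : n ≠ 0) : weightCoeff r L n ≤ (n : ℝ)⁻¹ := by
  have hn0 : (0 : ℝ) < n := by positivity
  rw [weightCoeff, div_le_iff₀ (by positivity)]
  have h1 : (n : ℝ)⁻¹ * (r * n + 1) = r + (n : ℝ)⁻¹ := by field_simp
  rw [h1]
  have := Real.exp_pos (-((r + 1 / (n : ℝ)) * L))
  have : 0 < (n : ℝ)⁻¹ := by positivity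
  linarith

lemma integral_weight {r L : ℝ} (hr : 0 < r) (hL : 0 ≤ L) {n : ℕ} (hn : n ≠ 0) :
    IntegrableOn (fun y => Real.exp (-y / (n : ℝ) ^ 2) * erfWeight r L y) (Ioi 0) ∧
    ∫ y in Ioi (0 : ℝ), Real.exp (-y / (n : ℝ) ^ 2) * erfWeight r L y =
      (n : ℝ) ^ 2 * weightCoeff r L n := by
  have hn0 : (0 : ℝ) < n := by positivity
  have h := laplace_erfWeight hr hL (a := 1 / n) (by positivity)
  have e : ∀ y : ℝ, -((1 / (n : ℝ)) ^ 2 * y) = -y / (n : ℝ) ^ 2 := fun y => by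
    field_simp
  simp_rw [e] at h
  refine ⟨h.1, h.2.trans ?_⟩
  rw [weightCoeff]
  field_simp

/-- To leading order the coefficient is a constant over n, with error O(1/n²) because 1 - e^{-L/n} ≤
L/n. Convergence of the Möbius series with these coefficients thus reduces to that of ∑ μ(n)/n. -/
lemma abs_weightCoeff_sub_le {r L : ℝ} (hr : 1 ≤ r) (hL : 0 ≤ L) {n : ℕ} (hn : n ≠ 0) :
    |weightCoeff r L n - (1 - Real.exp (-(r * L))) / r / n| ≤ (r * L + 1) / (n : ℝ) ^ 2 := by
  have hn0 : (0 : ℝ) < n := by positivity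
  have hr0 : 0 < r := by linarith
  set q := Real.exp (-(r * L)) with hq
  set p := Real.exp (-(L / n)) with hp
  have e1 : Real.exp (-((r + 1 / (n : ℝ)) * L)) = q * p := by
    rw [hq, hp, ← Real.exp_add]; congr 1; ring
  have hq0 : 0 < q := Real.exp_pos _
  have hq1 : q ≤ 1 := Real.exp_le_one_iff.2 (neg_nonpos.2 (by positivity))
  have hp1 : p ≤ 1 := Real.exp_le_one_iff.2 (neg_nonpos.2 (by positivity))
  have hp2 : 1 - p ≤ L / n := by
    have := Real.add_one_le_exp (-(L / n))
    linarith
  have e2 : weightCoeff r L n - (1 - q) / r / n =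
      (r * n * (q * (1 - p)) - (1 - q)) / (r * n * (r * n + 1)) := by
    rw [weightCoeff, e1]; field_simp; ring
  have h1 : r * n * (q * (1 - p)) ≤ r * L := by
    calc r * n * (q * (1 - p)) ≤ r * n * (1 * (L / n)) := by gcongr
      _ = r * L := by field_simp
  have h2 : 0 ≤ r * n * (q * (1 - p)) :=
    mul_nonneg (by positivity) (mul_nonneg hq0.le (by linarith))
  have hd : (n : ℝ) ^ 2 ≤ r * n * (r * n + 1) := by
    have : (n : ℝ) ≤ r * n := le_mul_of_one_le_left hn0.le hr
    nlinarith
  rw [e2, abs_div, abs_of_pos (by positivity : 0 < r * n * (r * (n : ℝ) + 1))]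
  have h3 : |r * n * (q * (1 - p)) - (1 - q)| ≤ r * L + 1 := by
    rw [abs_le]; constructor <;> nlinarith [mul_nonneg hr0.le hL]
  gcongr

lemma exists_tendsto_sum_moebius_mul_weightCoeff {r L : ℝ} (hr : 1 ≤ r) (hL : 0 ≤ L) :
    ∃ l : ℝ, Tendsto (fun N : ℕ => ∑ n ∈ Finset.Icc 1 N,
      (ArithmeticFunction.moebius n : ℝ) * weightCoeff r L n) atTop (𝓝 l) := by
  obtain ⟨l, hl⟩ := exists_tendsto_sum_moebius_div
  set c := (1 - Real.exp (-(r * L))) / r with hc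
  set e : ℕ → ℝ := fun n => if n = 0 then 0 else
    (ArithmeticFunction.moebius n : ℝ) * (weightCoeff r L n - c / n) with he
  have hsum : Summable e := by
    refine ((Real.summable_one_div_nat_pow.2 one_lt_two).mul_left (r * L + 1)).of_norm_bounded
      fun n => ?_
    by_cases hn : n = 0
    · simp [he, hn]
    · simp only [he, hn, if_false, norm_mul, Real.norm_eq_abs]
      rw [mul_one_div]
      exact (mul_le_of_le_one_left (abs_nonneg _) (norm_moebius_le_one n)).trans
        (abs_weightCoeff_sub_le hr hL hn)
  have ht := (hsum.hasSum.tendsto_sum_nat.comp (tendsto_add_atTop_nat 1)).add (hl.const_mul c)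
  refine ⟨_, ht.congr fun N => ?_⟩
  have : ∑ n ∈ Finset.range (N + 1), e n = ∑ n ∈ Finset.Icc 1 N, e n := by
    refine (Finset.sum_subset (fun n hn => ?_) fun n _ hn => ?_).symm
    · rw [Finset.mem_Icc] at hn
      exact Finset.mem_range.2 (by omega)
    · rw [Finset.mem_Icc] at hn
      have : n = 0 := by
        rename_i h; rw [Finset.mem_range] at h; omega
      simp [he, this]
  simp only [Function.comp]
  rw [this, Finset.mul_sum, ← Finset.sum_add_distrib]
  refine Finset.sum_congr rfl fun n hn => ?_
  have hn : n ≠ 0 := by rw [Finset.mem_Icc] at hn; omega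
  simp only [he, hn, if_false]
  ring

lemma norm_moebius_mul_weightCoeff_mul_rpow_le {r L : ℝ} (hr : 1 ≤ r) (hL : 0 ≤ L) (ε : ℝ) (n : ℕ) :
    |(ArithmeticFunction.moebius n : ℝ)| * weightCoeff r L n * (n : ℝ) ^ (-ε) ≤
      (n : ℝ) ^ (-(1 + ε)) := by
  rcases eq_or_ne n 0 with rfl | hn
  · simp; positivity
  have hn0 : (0 : ℝ) < n := by positivity
  rw [neg_add, Real.rpow_add hn0, Real.rpow_neg_one]
  gcongr
  exact (mul_le_of_le_one_left (weightCoeff_nonneg (by linarith) hL n) (norm_moebius_le_one n)).trans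
    (weightCoeff_le hr hn)

lemma hasSum_dampedRiesz {ε y : ℝ} (hε : 0 ≤ ε) (hy : 0 ≤ y) :
    HasSum (fun n : ℕ => (ArithmeticFunction.moebius n : ℝ) / (n : ℝ) ^ 2 *
      Real.exp (-y / (n : ℝ) ^ 2) * (n : ℝ) ^ (-ε)) (dampedRiesz ε y) := by
  refine Summable.hasSum ((Real.summable_one_div_nat_pow.2 one_lt_two).of_norm_bounded fun n => ?_)
  exact norm_dampedRiesz_term_le hε hy n

lemma measurable_dampedRiesz_restrict {ε : ℝ} (hε : 0 ≤ ε) :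
    AEStronglyMeasurable (dampedRiesz ε) (volume.restrict (Ioi 0)) := by
  refine aestronglyMeasurable_of_tendsto_ae atTop (f := fun (N : ℕ) y =>
    ∑ n ∈ Finset.range N, (ArithmeticFunction.moebius n : ℝ) / (n : ℝ) ^ 2 *
      Real.exp (-y / (n : ℝ) ^ 2) * (n : ℝ) ^ (-ε)) (fun N => ?_) ?_
  · exact (Continuous.aestronglyMeasurable (by fun_prop))
  · exact ae_restrict_of_forall_mem measurableSet_Ioi fun y hy =>
      (hasSum_dampedRiesz hε (le_of_lt hy)).tendsto_sum_nat

lemma dampedRiesz_zero : dampedRiesz 0 = rieszFunction := by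
  ext y
  simp [dampedRiesz, rieszFunction]

/-- The integrals of the absolute values of the terms are at most n^{-1-ε}, which is summable
exactly because of the damping. -/
lemma integral_dampedRiesz_mul {r L : ℝ} (hr : 1 ≤ r) (hL : 0 ≤ L) {ε : ℝ} (hε : 0 < ε) :
    ∫ y in Ioi (0 : ℝ), dampedRiesz ε y * erfWeight r L y =
      ∑' n : ℕ, (ArithmeticFunction.moebius n : ℝ) * weightCoeff r L n * (n : ℝ) ^ (-ε) := by
  have hr0 : 0 < r := by linarith
  set c : ℕ → ℝ := fun n => (ArithmeticFunction.moebius n : ℝ) / (n : ℝ) ^ 2 * (n : ℝ) ^ (-ε) with hc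
  set F : ℕ → ℝ → ℝ := fun n y => c n * (Real.exp (-y / (n : ℝ) ^ 2) * erfWeight r L y) with hF
  have hc0 : c 0 = 0 := by simp [hc]
  have hFi : ∀ n, Integrable (F n) (volume.restrict (Ioi 0)) := fun n => by
    rcases eq_or_ne n 0 with rfl | hn
    · simp only [hF, hc0, zero_mul]; exact integrable_zero _ _ _
    · exact (integral_weight hr0 hL hn).1.const_mul _
  have hnorm : ∀ n, ∫ y in Ioi (0 : ℝ), ‖F n y‖ =
      |(ArithmeticFunction.moebius n : ℝ)| * weightCoeff r L n * (n : ℝ) ^ (-ε) := fun n => by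
    rcases eq_or_ne n 0 with rfl | hn
    · simp [hF, hc0]
    have hn0 : (0 : ℝ) < n := by positivity
    have : ∀ y ∈ Ioi (0 : ℝ), ‖F n y‖ = |c n| * (Real.exp (-y / (n : ℝ) ^ 2) * erfWeight r L y) :=
      fun y hy => by
        rw [Real.norm_eq_abs, hF, abs_mul, abs_of_nonneg (mul_nonneg (Real.exp_pos _).le
          (erfWeight_nonneg r hL hy))]
    rw [setIntegral_congr_fun measurableSet_Ioi this, integral_const_mul, (integral_weight hr0 hL hn).2,
      hc, abs_mul, abs_div, abs_of_pos (by positivity : (0:ℝ) < (n : ℝ) ^ 2),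
      abs_of_nonneg (by positivity : 0 ≤ (n : ℝ) ^ (-ε))]
    field_simp
  have hsum : Summable fun n => ∫ y in Ioi (0 : ℝ), ‖F n y‖ := by
    simp_rw [hnorm]
    refine (Real.summable_nat_rpow.2 (by linarith : -(1 + ε) < -1)).of_nonneg_of_le (fun n => ?_)
      (norm_moebius_mul_weightCoeff_mul_rpow_le hr hL ε)
    exact mul_nonneg (mul_nonneg (abs_nonneg _) (weightCoeff_nonneg hr0 hL n)) (by positivity)
  have key := integral_tsum_of_summable_integral_norm hFi hsum
  have e1 : ∫ y in Ioi (0 : ℝ), dampedRiesz ε y * erfWeight r L y =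
      ∫ y in Ioi (0 : ℝ), ∑' n, F n y := by
    refine setIntegral_congr_fun measurableSet_Ioi fun y _ => ?_
    simp only [dampedRiesz, hF, hc]
    rw [← tsum_mul_right]
    exact tsum_congr fun n => by ring
  rw [e1, ← key]
  refine tsum_congr fun n => ?_
  rcases eq_or_ne n 0 with rfl | hn
  · simp [hF, hc0]
  have hn0 : (0 : ℝ) < n := by positivity
  simp only [hF]
  rw [integral_const_mul, (integral_weight hr0 hL hn).2]
  simp only [hc]
  field_simp

/-- The factors 1/(√y (1 + log² y)) and L/√y multiply to a majorant integrable at both 0 and ∞; the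
logarithmic saving is indispensable. -/
lemma exists_integrable_dampedRiesz_mul_bound {r L : ℝ} (hr : 0 ≤ r) (hL : 0 ≤ L) :
    ∃ D : ℝ → ℝ, IntegrableOn D (Ioi 0) ∧ ∀ ε : ℝ, 0 < ε → ε ≤ 1 → ∀ y, 0 < y →
      ‖dampedRiesz ε y * erfWeight r L y‖ ≤ D y := by
  obtain ⟨C, hC, h⟩ := exists_dampedRiesz_bound
  refine ⟨fun y => C * L * (1 / (y * (1 + Real.log y ^ 2))),
    integrableOn_one_div_mul_one_add_log_sq.const_mul _, fun ε h0 h1 y hy => ?_⟩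
  have hs : 0 < √y := Real.sqrt_pos.2 hy
  rw [norm_mul, Real.norm_eq_abs, Real.norm_of_nonneg (erfWeight_nonneg r hL hy)]
  refine (mul_le_mul (h ε h0 h1 y hy) (erfWeight_le hr hL hy) (erfWeight_nonneg r hL hy)
    (by positivity)).trans_eq ?_
  have : y = √y * √y := (Real.mul_self_sqrt hy.le).symm
  change _ = C * L * (1 / (y * (1 + Real.log y ^ 2)))
  rw [div_mul_div_comm, mul_one_div]
  congr 1
  linear_combination -(1 + Real.log y ^ 2) * this

/-- The integral of the Riesz function against the weight, with its series expansion. -/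
theorem integrableOn_rieszFunction_mul_and_tendsto {r L : ℝ} (hr : 1 ≤ r) (hL : 0 ≤ L) :
    IntegrableOn (fun y => rieszFunction y * erfWeight r L y) (Ioi 0) ∧
    Tendsto (fun N : ℕ => ∑ n ∈ Finset.Icc 1 N,
      (ArithmeticFunction.moebius n : ℝ) * weightCoeff r L n) atTop
      (𝓝 (∫ y in Ioi (0 : ℝ), rieszFunction y * erfWeight r L y)) := by
  have hr0 : 0 < r := by linarith
  obtain ⟨D, hD, hb⟩ := exists_integrable_dampedRiesz_mul_bound hr0.le hL
  have hm : ∀ ε : ℝ, 0 ≤ ε → AEStronglyMeasurable (fun y => dampedRiesz ε y * erfWeight r L y)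
      (volume.restrict (Ioi 0)) := fun ε hε =>
    (measurable_dampedRiesz_restrict hε).mul (measurable_erfWeight r L).aestronglyMeasurable
  have hIoo : ∀ᶠ ε : ℝ in 𝓝[>] 0, ε ∈ Ioo (0 : ℝ) 1 := Ioo_mem_nhdsGT zero_lt_one
  have hlim : ∀ y ∈ Ioi (0 : ℝ), Tendsto (fun ε => dampedRiesz ε y * erfWeight r L y) (𝓝[>] 0)
      (𝓝 (rieszFunction y * erfWeight r L y)) := fun y hy =>
    (tendsto_dampedRiesz (le_of_lt hy)).mul_const _
  have hint : IntegrableOn (fun y => rieszFunction y * erfWeight r L y) (Ioi 0) := by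
    refine hD.mono' (by simpa [dampedRiesz_zero] using hm 0 le_rfl) ?_
    refine ae_restrict_of_forall_mem measurableSet_Ioi fun y hy => ?_
    refine le_of_tendsto (hlim y hy).norm ?_
    filter_upwards [hIoo] with ε hε using hb ε hε.1 hε.2.le y hy
  refine ⟨hint, ?_⟩
  have hdct : Tendsto (fun ε => ∫ y in Ioi (0 : ℝ), dampedRiesz ε y * erfWeight r L y) (𝓝[>] 0)
      (𝓝 (∫ y in Ioi (0 : ℝ), rieszFunction y * erfWeight r L y)) := by
    refine tendsto_integral_filter_of_dominated_convergence D ?_ ?_ hD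
      (ae_restrict_of_forall_mem measurableSet_Ioi hlim)
    · filter_upwards [hIoo] with ε hε using hm ε hε.1.le
    · filter_upwards [hIoo] with ε hε
      exact ae_restrict_of_forall_mem measurableSet_Ioi (hb ε hε.1 hε.2.le)
  obtain ⟨l, hl⟩ := exists_tendsto_sum_moebius_mul_weightCoeff hr hL
  have habel := tendsto_tsum_mul_rpow_neg (by simp) hl fun ε hε => by
    refine (Real.summable_nat_rpow.2 (by linarith : -(1 + ε) < -1)).of_norm_bounded fun n => ?_
    rw [norm_mul, norm_mul, Real.norm_eq_abs, Real.norm_of_nonneg (weightCoeff_nonneg hr0 hL n),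
      Real.norm_of_nonneg (by positivity)]
    exact norm_moebius_mul_weightCoeff_mul_rpow_le hr hL ε n
  have heq : Tendsto (fun ε => ∫ y in Ioi (0 : ℝ), dampedRiesz ε y * erfWeight r L y) (𝓝[>] 0)
      (𝓝 l) := by
    refine habel.congr' ?_
    filter_upwards [self_mem_nhdsWithin] with ε hε
    exact (integral_dampedRiesz_mul hr hL hε).symm
  -- The same damped integrals tend to the Riesz integral by dominated convergence and to the sum of
  -- the series by Abel's theorem.
  rwa [tendsto_nhds_unique hdct heq]

end RieszFunction

/-- The series over `n` on the left converges only conditionally, so its value is stated as the limit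
of its partial sums; the integral is an absolutely convergent Lebesgue integral. -/
theorem theorem2p4 (X r : ℝ) (hX : 1 < X) (hr : 1 ≤ r) :
    MeasureTheory.IntegrableOn
      (fun y : ℝ => rieszFunction y *
        (Real.exp (y * r ^ 2) *
          (erf (Real.sqrt y * (r + Real.log X / (2 * y))) - erf (r * Real.sqrt y))))
      (Set.Ioi 0) MeasureTheory.volume ∧
    Filter.Tendsto
      (fun N : ℕ => (1 / 2 : ℝ) * ∑ n ∈ Finset.Icc 1 N,
        (ArithmeticFunction.moebius n : ℝ) / (r * (n : ℝ) + 1) *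
          (X ^ (-(r + 1 / (n : ℝ))) - 1))
      Filter.atTop
      (nhds (-(1 / 2 : ℝ) * ∫ y in Set.Ioi (0 : ℝ), rieszFunction y *
        (Real.exp (y * r ^ 2) *
          (erf (Real.sqrt y * (r + Real.log X / (2 * y))) - erf (r * Real.sqrt y))))) := by
  obtain ⟨hint, hlim⟩ := integrableOn_rieszFunction_mul_and_tendsto hr (Real.log_nonneg hX.le)
  refine ⟨hint, ?_⟩
  refine (hlim.const_mul (-(1 / 2 : ℝ))).congr fun N => ?_
  rw [Finset.mul_sum, Finset.mul_sum]
  refine Finset.sum_congr rfl fun n _ => ?_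
  -- X^{-(r+1/n)} - 1 is minus the numerator of `weightCoeff`, which accounts for the sign of the
  -- factor -1/2.
  rw [weightCoeff, Real.rpow_def_of_pos (by linarith), mul_neg, mul_comm (Real.log X)]
  ring
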